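/- Let $R$ be a real closed field and $C = R[i]$, $i^2=-1$. *Cauchy index.* For $P\in R[X]\setminus\{0\}$ and $x \in R$ write $P = (X-x)^{\mathrm{mult}_x(P)}P_x$ with $P_x(x)\neq 0$, and for $P,Q\ne 0$ put $\mathrm{val}_x(P/Q)=\mathrm{mult}_x(P)-\mathrm{mult}_x(Q)$. For $P,Q\in R[X]$, if $P\neq0$, $Q\neq 0$ and $v=\mathrm{val}_x(P/Q)<0$, put $$\mathrm{Ind}_x^{+}(P,Q)=\tfrac12\,\mathrm{sign}(P_x(x)Q_x(x)),\qquad \mathrm{Ind}_x^{-}(P,Q)=\tfrac12(-1)^{v}\,\mathrm{sign}(P_x(x)Q_x(x)),$$ and otherwise put $\mathrm{Ind}_x^{\pm}(P,Q)=0$. For $a<b$ let $$\mathrm{Ind}_a^b(P,Q)=\mathrm{Ind}_a^+(P,Q)+\sum_{x\in(a,b)}\bigl(\mathrm{Ind}_x^+(P,Q)-\mathrm{Ind}_x^-(P,Q)\bigr)-\mathrm{Ind}_b^-(P,Q),$$ let $\mathrm{Ind}_b^a(P,Q)=-\mathrm{Ind}_a^b(P,Q)$, and $\mathrm{Ind}_a^a(P,Q)=0$.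 *Winding number.* Let $\Gamma=[x_0,x_1]\times[y_0,y_1]\subset R^2$ with $x_0<x_1$, $y_0<y_1$; identify $R^2$ with $C$ by $(x,y)\mapsto x+iy$. For $F = F_{\mathrm{re}}+iF_{\mathrm{im}}\in C[X,Y]$ with $F_{\mathrm{re}},F_{\mathrm{im}}\in R[X,Y]$, let $\overline F=F_{\mathrm{re}}-iF_{\mathrm{im}}$ and $$w(F\mid\partial\Gamma)=\tfrac12\Bigl(\mathrm{Ind}_{x_0}^{x_1}(F_{\mathrm{re}}(T,y_0),F_{\mathrm{im}}(T,y_0))+\mathrm{Ind}_{y_0}^{y_1}(F_{\mathrm{re}}(x_1,T),F_{\mathrm{im}}(x_1,T))$$ $$\qquad\qquad+\,\mathrm{Ind}_{x_1}^{x_0}(F_{\mathrm{re}}(T,y_1),F_{\mathrm{im}}(T,y_1))+\mathrm{Ind}_{y_1}^{y_0}(F_{\mathrm{re}}(x_0,T),F_{\mathrm{im}}(x_0,T))\Bigr).$$ Regard $C[Z]\subset C[X,Y]$ through $Z=X+iY$. For $F,G\in C[Z]$ with $G \neq 0$, put $w(F/G\mid\partial\Gamma)=w(F\overline G\mid\partial\Gamma)$.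 **Theorem.** Let $F,G\in C[Z]\setminus\{0\}$ (not necessarily coprime) and let $\Gamma=[x_0,x_1]\times[y_0,y_1]$ be a rectangle as above such that the rational function $F/G\in C(Z)\setminus\{0\}$ has no zeros or poles at the vertices of $\Gamma$. Then $$w(F/G\mid\partial\Gamma)=\bigl(N_{\mathrm{int}}-P_{\mathrm{int}}\bigr)+\tfrac12\bigl(N_{\mathrm{edge}}-P_{\mathrm{edge}}\bigr),$$ where $N_{\mathrm{int}}$ and $P_{\mathrm{int}}$ are the numbers of zeros (with multiplicity) and of poles (with order) of $F/G$ in the interior $\{x+iy : x_0<x<x_1,\ y_0<y<y_1\}$ of $\Gamma$, and $N_{\mathrm{edge}}$ and $P_{\mathrm{edge}}$ are the corresponding numbers on the edges of $\Gamma$, vertices excluded. In particular ($G=1$), this holds for every nonzero polynomial $F\in C[Z]$ without roots at the vertices, even if it has roots on the edges. -/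

import Mathlib

noncomputable section

namespace AlgWinding

/-! ### Cauchy index of a pair of real polynomials -/

section Real

variable {R : Type*} [Field R]

/-- The cofactor `P_x` in `P = (X - x) ^ mult_x(P) * P_x`; for `P ≠ 0` it does not vanish
at `x`. -/
def cofactor (P : Polynomial R) (x : R) : Polynomial R :=
  P /ₘ (Polynomial.X - Polynomial.C x) ^ P.rootMultiplicity x

/-- The valuation `val_x(P/Q) = mult_x(P) - mult_x(Q)` of a quotient of nonzero polynomials,
over any commutative ring of coefficients. (The value `+∞` for `P = 0` is never used:
nonvanishing is always required separately.) -/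
def val {K : Type*} [CommRing K] (P Q : Polynomial K) (x : K) : ℤ :=
  (P.rootMultiplicity x : ℤ) - (Q.rootMultiplicity x : ℤ)

variable [LinearOrder R]

/-- The sign of `P_x(x) Q_x(x)`, as a rational number in `{-1, 0, 1}`. -/
def cofactorSign (P Q : Polynomial R) (x : R) : ℚ :=
  ((SignType.sign ((cofactor P x).eval x * (cofactor Q x).eval x) : SignType) : ℚ)

open Classical in
/-- The right Cauchy index `Ind_x^+(P, Q)` at a point. -/
def indRight (P Q : Polynomial R) (x : R) : ℚ :=
  if P ≠ 0 ∧ Q ≠ 0 ∧ val P Q x < 0 then 1 / 2 * cofactorSign P Q x else 0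

open Classical in
/-- The left Cauchy index `Ind_x^-(P, Q)` at a point. -/
def indLeft (P Q : Polynomial R) (x : R) : ℚ :=
  if P ≠ 0 ∧ Q ≠ 0 ∧ val P Q x < 0 then
    1 / 2 * (-1 : ℚ) ^ (val P Q x) * cofactorSign P Q x
  else 0

/-- The Cauchy index `Ind_x(P, Q)` at a point. -/
def indPt (P Q : Polynomial R) (x : R) : ℚ :=
  indRight P Q x - indLeft P Q x

/-- The expression for the Cauchy index on `[a, b]` when `a < b`. Only finitely many terms of
the sum are nonzero, as `indPt P Q x ≠ 0` forces `Q ≠ 0` and `Q(x) = 0`. -/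
def indIncr (P Q : Polynomial R) (a b : R) : ℚ :=
  indRight P Q a + (∑ᶠ x ∈ Set.Ioo a b, indPt P Q x) - indLeft P Q b

/-- The Cauchy index `Ind_a^b(P, Q)`, for arbitrary `a` and `b`. -/
def cauchyIndex (P Q : Polynomial R) (a b : R) : ℚ :=
  if a < b then indIncr P Q a b else if b < a then -indIncr P Q b a else 0

end Real

/-! ### The field `R[i]` and polynomials in two variables over it -/

/-- `R[i]`, the quadratic algebra over `R` generated by `i` with `i² = -1`. -/
abbrev Cplx (R : Type*) [Field R] : Type _ := QuadraticAlgebra R (-1) 0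

section Complex

variable {R : Type*} [Field R]

/-- The imaginary unit. -/
def I : Cplx R := ⟨0, 1⟩

/-- The real part `F_re ∈ R[X, Y]` of `F ∈ R[i][X, Y]`. -/
def rePart (F : MvPolynomial (Fin 2) (Cplx R)) : MvPolynomial (Fin 2) R :=
  ∑ m ∈ F.support, MvPolynomial.monomial m (F.coeff m).re

/-- The imaginary part `F_im ∈ R[X, Y]` of `F ∈ R[i][X, Y]`. -/
def imPart (F : MvPolynomial (Fin 2) (Cplx R)) : MvPolynomial (Fin 2) R :=
  ∑ m ∈ F.support, MvPolynomial.monomial m (F.coeff m).im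

theorem coeff_rePart (F : MvPolynomial (Fin 2) (Cplx R)) (m : Fin 2 →₀ ℕ) :
    (rePart F).coeff m = (F.coeff m).re := by
  classical
  simp only [rePart, MvPolynomial.coeff_sum, MvPolynomial.coeff_monomial]
  rw [Finset.sum_ite_eq' F.support m]
  split_ifs with h
  · rfl
  · rw [MvPolynomial.notMem_support_iff.mp h]; rfl

theorem coeff_imPart (F : MvPolynomial (Fin 2) (Cplx R)) (m : Fin 2 →₀ ℕ) :
    (imPart F).coeff m = (F.coeff m).im := by
  classical
  simp only [imPart, MvPolynomial.coeff_sum, MvPolynomial.coeff_monomial]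
  rw [Finset.sum_ite_eq' F.support m]
  split_ifs with h
  · rfl
  · rw [MvPolynomial.notMem_support_iff.mp h]; rfl

/-- The conjugate polynomial `F_re - i F_im`, with conjugated coefficients. -/
def conj (F : MvPolynomial (Fin 2) (Cplx R)) : MvPolynomial (Fin 2) (Cplx R) :=
  MvPolynomial.map (starRingEnd (Cplx R)) F

/-- The inclusion `R[i][Z] ⊂ R[i][X, Y]` given by `Z = X + i Y`. -/
def toXY (F : Polynomial (Cplx R)) : MvPolynomial (Fin 2) (Cplx R) :=
  Polynomial.aeval (MvPolynomial.X 0 + MvPolynomial.C I * MvPolynomial.X 1) F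

/-- `H(T, y) ∈ R[T]` for `H ∈ R[X, Y]`. -/
def restrictHoriz (H : MvPolynomial (Fin 2) R) (y : R) : Polynomial R :=
  MvPolynomial.aeval ![Polynomial.X, Polynomial.C y] H

/-- `H(x, T) ∈ R[T]` for `H ∈ R[X, Y]`. -/
def restrictVert (H : MvPolynomial (Fin 2) R) (x : R) : Polynomial R :=
  MvPolynomial.aeval ![Polynomial.C x, Polynomial.X] H

end Complex

/-! ### Rectangles and winding numbers -/

/-- A nondegenerate rectangle `[x₀, x₁] × [y₀, y₁]`. -/
structure Rectangle (R : Type*) [LT R] where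
  x₀ : R
  x₁ : R
  y₀ : R
  y₁ : R
  hx : x₀ < x₁
  hy : y₀ < y₁

section Winding

variable {R : Type*} [Field R] [LinearOrder R]

/-- The four vertices, as points of `R[i]`. -/
def Rectangle.vertices (Γ : Rectangle R) : Set (Cplx R) :=
  {z | (z.re = Γ.x₀ ∨ z.re = Γ.x₁) ∧ (z.im = Γ.y₀ ∨ z.im = Γ.y₁)}

/-- The union of the four edges without their endpoints. -/
def Rectangle.edges (Γ : Rectangle R) : Set (Cplx R) :=
  {z | (z.re ∈ Set.Ioo Γ.x₀ Γ.x₁ ∧ (z.im = Γ.y₀ ∨ z.im = Γ.y₁)) ∨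
    ((z.re = Γ.x₀ ∨ z.re = Γ.x₁) ∧ z.im ∈ Set.Ioo Γ.y₀ Γ.y₁)}

/-- The points strictly inside the rectangle. -/
def Rectangle.inside (Γ : Rectangle R) : Set (Cplx R) :=
  {z | z.re ∈ Set.Ioo Γ.x₀ Γ.x₁ ∧ z.im ∈ Set.Ioo Γ.y₀ Γ.y₁}

/-- The winding number `w(F | ∂Γ)` of `F ∈ R[i][X, Y]`. -/
def windingNumber (F : MvPolynomial (Fin 2) (Cplx R)) (Γ : Rectangle R) : ℚ :=
  1 / 2 *
    (cauchyIndex (restrictHoriz (rePart F) Γ.y₀) (restrictHoriz (imPart F) Γ.y₀) Γ.x₀ Γ.x₁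
      + cauchyIndex (restrictVert (rePart F) Γ.x₁) (restrictVert (imPart F) Γ.x₁) Γ.y₀ Γ.y₁
      + cauchyIndex (restrictHoriz (rePart F) Γ.y₁) (restrictHoriz (imPart F) Γ.y₁) Γ.x₁ Γ.x₀
      + cauchyIndex (restrictVert (rePart F) Γ.x₀) (restrictVert (imPart F) Γ.x₀) Γ.y₁ Γ.y₀)

/-- The winding number `w(F/G | ∂Γ) = w(F * conj G | ∂Γ)` of a quotient of polynomials
`F, G ∈ R[i][Z]`. -/
def windingNumberQuot (F G : Polynomial (Cplx R)) (Γ : Rectangle R) : ℚ :=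
  windingNumber (toXY F * conj (toXY G)) Γ

/-- The number of zeros of `F/G` in `S`, with multiplicity (`F, G ≠ 0`): a zero is a point of
positive valuation, and its multiplicity is the valuation. -/
def zeroCount (F G : Polynomial (Cplx R)) (S : Set (Cplx R)) : ℕ :=
  ∑ᶠ z ∈ S, (val F G z).toNat

/-- The number of poles of `F/G` in `S`, with order (`F, G ≠ 0`): a pole is a point of negative
valuation, and its order is minus the valuation. -/
def poleCount (F G : Polynomial (Cplx R)) (S : Set (Cplx R)) : ℕ :=
  ∑ᶠ z ∈ S, (-val F G z).toNat

end Winding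

end AlgWinding

end

noncomputable section

namespace AlgWinding

open Polynomial

/-! ### Algebraic closedness by Galois theory -/

section AlgClosed

variable {R : Type*} [Field R] [IsRealClosed R]

/-! The winding number behaves like a logarithm. Along an edge, the Cauchy index of a product `FG`
is the sum of the indices of `F` and `G`, minus half the increment of the sign of `Im(FG) Im(F)
Im(G)` (`indIncr_mul`). Around the closed boundary these increments cancel at the vertices, so the
winding number is additive when neither factor vanishes at a vertex (`windingNumber_mul`). Zeros on
the open edges do no harm: there they only give the real and imaginary parts a common real factor,
which the index ignores. Conjugation changes the sign of the winding number.

As `R[i]` is algebraically closed, `F` and `G` split into linear factors. The winding number of `Z -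
z` is computed directly: 1 for `z` inside, 1/2 on an open edge, 0 outside (`windingNumber_X_sub_C`).
At a vertex `F` and `G` may vanish to the same order; each such pair of factors puts the real
polynomial `|Z - z|²` into `F * conj G`, and this can be cancelled (`windingNumberQuot_mul_left`).

Two facts about real closed fields are needed: `R[i]` is algebraically closed, by Sylow and Galois
theory; and a polynomial without roots on an interval keeps its sign there. The second follows from
the first, since irreducible polynomials over `R` have degree at most 2. -/

theorem finrank_eq_one_of_odd {E : Type*} [Field E] [Algebra R E] [FiniteDimensional R E]
    [Algebra.IsSeparable R E] (h : Odd (Module.finrank R E)) : Module.finrank R E = 1 := by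
  obtain ⟨α, hα⟩ := Field.exists_primitive_element R E
  have hint : IsIntegral R α := Algebra.IsIntegral.isIntegral α
  have hdeg : (minpoly R α).natDegree = Module.finrank R E :=
    (Field.primitive_element_iff_minpoly_natDegree_eq R α).1 hα
  rw [← hdeg] at h ⊢
  obtain ⟨x, hx⟩ := IsRealClosed.exists_isRoot_of_odd_natDegree h
  exact natDegree_eq_of_degree_eq_some
    (degree_eq_one_of_irreducible_of_root (minpoly.irreducible hint) hx)

/-- Quadratic formula: a generator would have a quadratic minimal polynomial, whose discriminant is
a square in `K`. -/
theorem finrank_ne_two_of_isSquare {K M : Type*} [Field K] [CharZero K]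
    (hsq : ∀ x : K, IsSquare x) [Field M] [Algebra K M] : Module.finrank K M ≠ 2 := by
  intro h
  have : FiniteDimensional K M := Module.finite_of_finrank_pos (by omega)
  obtain ⟨α, hα⟩ := Field.exists_primitive_element K M
  have hint : IsIntegral K α := Algebra.IsIntegral.isIntegral α
  have hdeg : (minpoly K α).natDegree = 2 :=
    ((Field.primitive_element_iff_minpoly_natDegree_eq K α).1 hα).trans h
  have hirr := minpoly.irreducible hint
  have hmon := minpoly.monic hint
  set p := minpoly K α
  obtain ⟨d, hd⟩ := hsq (p.coeff 1 ^ 2 - 4 * p.coeff 0)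
  have hc2 : p.coeff 2 = 1 := by rw [← hdeg]; exact hmon
  have hroot : p.IsRoot ((-p.coeff 1 + d) / 2) := by
    rw [IsRoot, eval_eq_sum_range, hdeg]
    simp only [Finset.sum_range_succ, Finset.sum_range_zero, hc2]
    field_simp
    linear_combination (-1 : K) * hd
  have := natDegree_eq_of_degree_eq_some (degree_eq_one_of_irreducible_of_root hirr hroot)
  rw [hdeg] at this
  exact absurd this (by norm_num)

/-- The fixed field of a Sylow 2-subgroup has odd degree over `R`, hence is `R`, so `Gal(E/R)` is a
2-group and `[E : K]` is a power of 2. Were it not 1, a subgroup of index 2 in `Gal(E/K)` would fix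
a quadratic extension of `K`. -/
theorem finrank_eq_one_of_isGalois {K E : Type*} [Field K] [CharZero K] [Field E] [Algebra R K]
    [Algebra K E] [Algebra R E] [IsScalarTower R K E] [FiniteDimensional R E] [IsGalois R E]
    (hsq : ∀ x : K, IsSquare x) : Module.finrank K E = 1 := by
  have : Fact (Nat.Prime 2) := ⟨Nat.prime_two⟩
  have : FiniteDimensional K E := FiniteDimensional.right R K E
  have : IsGalois K E := IsGalois.tower_top_of_isGalois R K E
  let P : Sylow 2 Gal(E/R) := default
  have hP : Odd (Module.finrank R (IntermediateField.fixedField (P : Subgroup Gal(E/R)))) := by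
    have h1 := Module.finrank_mul_finrank R
      (IntermediateField.fixedField (P : Subgroup Gal(E/R))) E
    rw [IntermediateField.finrank_fixedField_eq_card, ← IsGalois.card_aut_eq_finrank R E,
      ← (P : Subgroup Gal(E/R)).index_mul_card] at h1
    rw [Nat.eq_of_mul_eq_mul_right Nat.card_pos h1, ← Nat.not_even_iff_odd, even_iff_two_dvd]
    exact P.not_dvd_index
  have h1 := finrank_eq_one_of_odd hP
  have hcard : ∃ n, Nat.card Gal(E/R) = 2 ^ n := by
    have h2 := Module.finrank_mul_finrank R
      (IntermediateField.fixedField (P : Subgroup Gal(E/R))) E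
    rw [IntermediateField.finrank_fixedField_eq_card, ← IsGalois.card_aut_eq_finrank R E, h1,
      one_mul] at h2
    obtain ⟨n, hn⟩ := (IsPGroup.iff_card (p := 2)).1 P.isPGroup'
    exact ⟨n, by rw [← h2]; exact hn⟩
  obtain ⟨n, hn⟩ := hcard
  rw [IsGalois.card_aut_eq_finrank, ← Module.finrank_mul_finrank R K E] at hn
  obtain ⟨m, -, hm⟩ := (Nat.dvd_prime_pow Nat.prime_two).1 (Dvd.intro_left _ hn)
  rcases m with _ | m
  · simpa using hm
  exfalso
  obtain ⟨H, hH⟩ := Sylow.exists_subgroup_card_pow_prime (G := Gal(E/K)) 2 (n := m)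
    (by rw [IsGalois.card_aut_eq_finrank, hm]; exact pow_dvd_pow _ (by omega))
  have h3 := Module.finrank_mul_finrank K (IntermediateField.fixedField H) E
  rw [IntermediateField.finrank_fixedField_eq_card, hH, hm, pow_succ'] at h3
  exact finrank_ne_two_of_isSquare hsq (Nat.eq_of_mul_eq_mul_right (by positivity) h3)

/-- For a root `α` in an algebraic closure, the normal closure of `K(α)` over `R` is Galois over
`R`, so it has degree 1 over `K` and `α` already lies in `K`. -/
theorem isAlgClosed_of_isSquare {K : Type*} [Field K] [CharZero R] [Algebra R K]
    [FiniteDimensional R K] (hsq : ∀ x : K, IsSquare x) : IsAlgClosed K := by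
  have : CharZero K := charZero_of_injective_algebraMap (algebraMap R K).injective
  refine IsAlgClosed.of_exists_root _ fun p _ hp => ?_
  obtain ⟨α, hα⟩ := IsAlgClosed.exists_aeval_eq_zero (AlgebraicClosure K) p hp.degree_pos.ne'
  let L := IntermediateField.adjoin K {α}
  have : FiniteDimensional K L := IntermediateField.adjoin.finiteDimensional
    (Algebra.IsIntegral.isIntegral α)
  have : FiniteDimensional R L := FiniteDimensional.trans R K L
  have : Algebra.IsAlgebraic R (AlgebraicClosure K) := Algebra.IsAlgebraic.trans R K _
  have : IsAlgClosure R (AlgebraicClosure K) := ⟨inferInstance, inferInstance⟩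
  have : Normal R (AlgebraicClosure K) := IsAlgClosure.normal R _
  let E := IntermediateField.normalClosure R L (AlgebraicClosure K)
  have : FiniteDimensional R E := inferInstance
  have : IsGalois R E := ⟨⟩
  have : IsScalarTower R L (AlgebraicClosure K) := IsScalarTower.of_algebraMap_eq fun r => by
    rw [IsScalarTower.algebraMap_apply R K L, IsScalarTower.algebraMap_apply R K]; rfl
  let _ : Algebra L E := normalClosure.algebra R L (AlgebraicClosure K)
  have : IsScalarTower R L E := IsScalarTower.of_algebraMap_eq fun r => Subtype.ext <|
    IsScalarTower.algebraMap_apply R L (AlgebraicClosure K) r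
  let _ : Algebra K E := ((algebraMap L E).comp (algebraMap K L)).toAlgebra
  have : IsScalarTower K L E := IsScalarTower.of_algebraMap_eq fun _ => rfl
  have : IsScalarTower R K E := IsScalarTower.of_algebraMap_eq fun r => by
    rw [IsScalarTower.algebraMap_apply R L E, IsScalarTower.algebraMap_apply R K L]; rfl
  have h1 := finrank_eq_one_of_isGalois (R := R) (K := K) (E := E) hsq
  obtain ⟨x, hx⟩ := (finrank_eq_one_iff_of_nonzero' (1 : E) one_ne_zero).1 h1
    (algebraMap L E (IntermediateField.AdjoinSimple.gen K α))
  rw [← Algebra.algebraMap_eq_smul_one] at hx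
  refine ⟨x, ?_⟩
  have h2 : algebraMap K L x = IntermediateField.AdjoinSimple.gen K α :=
    (algebraMap L E).injective hx
  have h3 : algebraMap K (AlgebraicClosure K) x = α := congrArg Subtype.val h2
  rw [← h3, aeval_algebraMap_apply, map_eq_zero] at hα
  simpa using hα

end AlgClosed

/-! ### Square roots in `R[i]` and the intermediate value property -/

section Ordered

variable {R : Type*} [Field R] [LinearOrder R] [IsStrictOrderedRing R]

-- The condition under which `QuadraticAlgebra R (-1) 0` is a field.
scoped instance fact_sq_ne : Fact (∀ r : R, r ^ 2 ≠ -1 + 0 * r) :=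
  ⟨fun r h => by nlinarith [sq_nonneg r]⟩

variable [IsRealClosed R]

/-- With `|r|` the modulus of `a + bi`, the root is `u ± vi` where `u² = (|r| + a)/2` and `v² = (|r|
- a)/2`. These force `(2uv)² = b²`, and the sign is chosen to match `b`. -/
theorem isSquare_cplx (z : Cplx R) : IsSquare z := by
  obtain ⟨a, b⟩ := z
  obtain ⟨r, hr⟩ := IsRealClosed.nonneg_iff_isSquare.1 (add_nonneg (sq_nonneg a) (sq_nonneg b))
  have habs : a ^ 2 + b ^ 2 = |r| ^ 2 := by rw [sq_abs, hr, sq]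
  obtain ⟨u, hu⟩ := IsRealClosed.nonneg_iff_isSquare.1
    (show 0 ≤ (|r| + a) / 2 by
      have := abs_le_of_sq_le_sq (show a ^ 2 ≤ |r| ^ 2 by nlinarith [sq_nonneg b]) (abs_nonneg r)
      linarith [(abs_le.1 this).1])
  obtain ⟨v, hv⟩ := IsRealClosed.nonneg_iff_isSquare.1
    (show 0 ≤ (|r| - a) / 2 by
      have := abs_le_of_sq_le_sq (show a ^ 2 ≤ |r| ^ 2 by nlinarith [sq_nonneg b]) (abs_nonneg r)
      linarith [(abs_le.1 this).2])
  have huv : (2 * (u * v)) ^ 2 = b ^ 2 := by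
    rw [show (2 * (u * v)) ^ 2 = 4 * ((u * u) * (v * v)) by ring, ← hu, ← hv]
    linear_combination -habs
  rcases sq_eq_sq_iff_eq_or_eq_neg.1 huv with h | h
  · refine ⟨⟨u, v⟩, ?_⟩
    ext
    · simp only [QuadraticAlgebra.re_mul]; linear_combination hu - hv
    · simp only [QuadraticAlgebra.im_mul]; linear_combination -h
  · refine ⟨⟨u, -v⟩, ?_⟩
    ext
    · simp only [QuadraticAlgebra.re_mul]; linear_combination hu - hv
    · simp only [QuadraticAlgebra.im_mul]; linear_combination h

instance isAlgClosed_cplx : IsAlgClosed (Cplx R) :=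
  isAlgClosed_of_isSquare (R := R) isSquare_cplx

theorem natDegree_le_two_of_irreducible {p : R[X]} (hp : Irreducible p) : p.natDegree ≤ 2 := by
  obtain ⟨z, hz⟩ := IsAlgClosed.exists_aeval_eq_zero (Cplx R) p hp.degree_pos.ne'
  have h1 := minpoly.natDegree_le (A := R) z
  rw [QuadraticAlgebra.finrank_eq_two] at h1
  have h2 := natDegree_eq_of_degree_eq (degree_eq_degree_of_associated
    ((minpoly.irreducible (Algebra.IsIntegral.isIntegral z)).associated_of_dvd hp
      (minpoly.dvd R z hz)))
  omega

/-- In degree 1, opposite signs at the ends would trap the root between them. In degree 2 the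
discriminant is negative, so by completing the square `p` always has the sign of its leading
coefficient. -/
theorem sign_eval_eq_of_irreducible {p : R[X]} (hp : Irreducible p) {a b : R} (hab : a ≤ b)
    (h : ∀ x ∈ Set.Icc a b, p.eval x ≠ 0) : SignType.sign (p.eval a) = SignType.sign (p.eval b) := by
  suffices 0 < p.eval a * p.eval b by
    rcases pos_and_pos_or_neg_and_neg_of_mul_pos this with h | h
    · rw [sign_pos h.1, sign_pos h.2]
    · rw [sign_neg h.1, sign_neg h.2]
  have hdeg := natDegree_le_two_of_irreducible hp
  have hpos := hp.natDegree_pos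
  have hev : ∀ x, p.eval x = p.coeff 0 + p.coeff 1 * x + p.coeff 2 * x ^ 2 := fun x => by
    rw [eval_eq_sum_range' (n := 3) (by omega)]
    simp [Finset.sum_range_succ]
  by_cases h2 : p.coeff 2 = 0
  · have h1 : p.coeff 1 ≠ 0 := by
      intro h1
      have : p.natDegree ≠ 2 := fun h => by
        have := leadingCoeff_ne_zero.2 hp.ne_zero
        rw [leadingCoeff, h] at this; exact this h2
      have h' : p.natDegree = 1 := by omega
      have := leadingCoeff_ne_zero.2 hp.ne_zero
      rw [leadingCoeff, h'] at this; exact this h1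
    by_contra! hle
    refine h (-p.coeff 0 / p.coeff 1) ?_ (by rw [hev, h2]; field_simp; ring)
    rw [hev, hev, h2] at hle
    set c := p.coeff 1
    set d := p.coeff 0
    have key : (a - -d / c) * (b - -d / c) ≤ 0 := by
      have : (a - -d / c) * (b - -d / c) * c ^ 2 = (d + c * a + 0 * a ^ 2) * (d + c * b + 0 * b ^ 2) := by
        field_simp; ring
      have hc : 0 < c ^ 2 := by positivity
      by_contra! hh
      nlinarith [mul_pos hh hc]
    constructor
    · by_contra! hh
      nlinarith [mul_pos (sub_pos.2 hh) (sub_pos.2 (hh.trans_le hab))]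
    · by_contra! hh
      nlinarith [mul_pos (sub_pos.2 hh) (sub_pos.2 (hab.trans_lt hh))]
  · have hd2 : p.natDegree = 2 := le_antisymm hdeg (le_natDegree_of_ne_zero h2)
    have hdisc : p.coeff 1 ^ 2 - 4 * p.coeff 2 * p.coeff 0 < 0 := by
      by_contra! hh
      obtain ⟨s, hs⟩ := IsRealClosed.nonneg_iff_isSquare.1 hh
      have hroot : p.IsRoot ((-p.coeff 1 + s) / (2 * p.coeff 2)) := by
        rw [IsRoot, hev]
        field_simp
        linear_combination (-1 : R) * hs
      have := natDegree_eq_of_degree_eq_some (degree_eq_one_of_irreducible_of_root hp hroot)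
      rw [hd2] at this
      exact absurd this (by norm_num)
    have hsq : ∀ x, 0 < p.coeff 2 * p.eval x := fun x => by
      rw [hev]
      nlinarith [sq_nonneg (2 * p.coeff 2 * x + p.coeff 1)]
    have := mul_pos (hsq a) (hsq b)
    have hc : 0 < p.coeff 2 ^ 2 := by positivity
    exact pos_of_mul_pos_right (a := p.coeff 2 ^ 2) (by linarith) hc.le

/-- A polynomial without roots on `[a, b]` has the same sign at `a` and `b`. -/
theorem sign_eval_eq {p : R[X]} {a b : R} (hab : a ≤ b) (h : ∀ x ∈ Set.Icc a b, p.eval x ≠ 0) :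
    SignType.sign (p.eval a) = SignType.sign (p.eval b) := by
  -- Signs are multiplicative, so irreducible factors suffice.
  induction p using WfDvdMonoid.induction_on_irreducible with
  | zero => simp
  | unit u hu => obtain ⟨c, -, rfl⟩ := isUnit_iff.1 hu; simp
  | mul q p hq hp ih =>
    simp only [eval_mul, sign_mul] at h ⊢
    rw [ih fun x hx => right_ne_zero_of_mul (h x hx),
      sign_eval_eq_of_irreducible hp hab fun x hx => left_ne_zero_of_mul (h x hx)]

end Ordered

/-! ### One-sided signs and the local Cauchy index -/

section Germs

variable {R : Type*} [Field R]

theorem pow_mul_cofactor (p : R[X]) (x : R) :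
    (X - C x) ^ p.rootMultiplicity x * cofactor p x = p :=
  pow_mul_divByMonic_rootMultiplicity_eq p x

theorem eval_cofactor_ne_zero {p : R[X]} (hp : p ≠ 0) (x : R) : (cofactor p x).eval x ≠ 0 :=
  eval_divByMonic_pow_rootMultiplicity_ne_zero x hp

theorem cofactor_zero (x : R) : cofactor (0 : R[X]) x = 0 := by
  simp [cofactor]

theorem cofactor_mul (p q : R[X]) (x : R) : cofactor (p * q) x = cofactor p x * cofactor q x := by
  rcases eq_or_ne p 0 with rfl | hp
  · simp [cofactor_zero]
  rcases eq_or_ne q 0 with rfl | hq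
  · simp [cofactor_zero]
  have h := pow_mul_cofactor (p * q) x
  rw [rootMultiplicity_mul (mul_ne_zero hp hq)] at h
  refine mul_left_cancel₀ (pow_ne_zero (p.rootMultiplicity x + q.rootMultiplicity x)
    (X_sub_C_ne_zero x)) ?_
  rw [h, pow_add]
  nth_rewrite 1 [← pow_mul_cofactor p x, ← pow_mul_cofactor q x]
  ring

theorem cofactor_of_eval_ne_zero {p : R[X]} {x : R} (h : p.eval x ≠ 0) : cofactor p x = p := by
  simp [cofactor, rootMultiplicity_eq_zero h]

variable [LinearOrder R]

/-- The sign of a polynomial immediately to the right of a point. -/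
def signRight (p : R[X]) (x : R) : SignType := SignType.sign ((cofactor p x).eval x)

/-- The sign of a polynomial immediately to the left of a point. -/
def signLeft (p : R[X]) (x : R) : SignType := (-1) ^ p.rootMultiplicity x * signRight p x

@[simp] theorem signRight_zero (x : R) : signRight (0 : R[X]) x = 0 := by
  simp [signRight, cofactor_zero]

@[simp] theorem signLeft_zero (x : R) : signLeft (0 : R[X]) x = 0 := by
  simp [signLeft]

theorem signRight_of_eval_ne_zero {p : R[X]} {x : R} (h : p.eval x ≠ 0) :
    signRight p x = SignType.sign (p.eval x) := by
  rw [signRight, cofactor_of_eval_ne_zero h]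

theorem signLeft_of_eval_ne_zero {p : R[X]} {x : R} (h : p.eval x ≠ 0) :
    signLeft p x = SignType.sign (p.eval x) := by
  rw [signLeft, signRight_of_eval_ne_zero h, rootMultiplicity_eq_zero h, pow_zero, one_mul]

variable [IsStrictOrderedRing R]

theorem cofactorSign_eq (P Q : R[X]) (x : R) :
    cofactorSign P Q x = (signRight P x : ℚ) * (signRight Q x : ℚ) := by
  rw [cofactorSign, sign_mul, SignType.coe_mul]; rfl

theorem signRight_mul (p q : R[X]) (x : R) :
    signRight (p * q) x = signRight p x * signRight q x := by
  rw [signRight, cofactor_mul, eval_mul, sign_mul]; rfl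

theorem signLeft_mul (p q : R[X]) (x : R) :
    signLeft (p * q) x = signLeft p x * signLeft q x := by
  rcases eq_or_ne p 0 with rfl | hp
  · simp
  rcases eq_or_ne q 0 with rfl | hq
  · simp
  rw [signLeft, signRight_mul, rootMultiplicity_mul (mul_ne_zero hp hq), pow_add, signLeft, signLeft]
  ac_rfl

omit [IsStrictOrderedRing R] in
theorem signRight_ne_zero {p : R[X]} (hp : p ≠ 0) (x : R) : signRight p x ≠ 0 :=
  sign_ne_zero.2 (eval_cofactor_ne_zero hp x)

theorem _root_.SignType.coe_mul_self {s : SignType} (h : s ≠ 0) : (s : ℚ) * s = 1 := by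
  revert h; cases s <;> simp

theorem val_mul_left {h P Q : R[X]} (hh : h ≠ 0) (hP : P ≠ 0) (hQ : Q ≠ 0) (x : R) :
    val (h * P) (h * Q) x = val P Q x := by
  rw [val, val, rootMultiplicity_mul (mul_ne_zero hh hP), rootMultiplicity_mul (mul_ne_zero hh hQ)]
  push_cast; ring

theorem cofactorSign_mul_left {h : R[X]} (hh : h ≠ 0) (P Q : R[X]) (x : R) :
    cofactorSign (h * P) (h * Q) x = cofactorSign P Q x := by
  simp only [cofactorSign_eq, signRight_mul, SignType.coe_mul]
  linear_combination (signRight P x : ℚ) * signRight Q x *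
    SignType.coe_mul_self (signRight_ne_zero hh x)

/-- A common factor leaves the valuation unchanged, and its sign enters the cofactor sign squared.
This is why common zeros of the real and imaginary parts on an edge can be divided out. -/
theorem indRight_mul_left {h : R[X]} (hh : h ≠ 0) (P Q : R[X]) (x : R) :
    indRight (h * P) (h * Q) x = indRight P Q x := by
  by_cases hP : P = 0
  · simp [indRight, hP]
  by_cases hQ : Q = 0
  · simp [indRight, hQ]
  simp only [indRight, mul_ne_zero_iff, val_mul_left hh hP hQ, cofactorSign_mul_left hh, ne_eq, hh,
    hP, hQ, not_false_eq_true, true_and]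

theorem indLeft_mul_left {h : R[X]} (hh : h ≠ 0) (P Q : R[X]) (x : R) :
    indLeft (h * P) (h * Q) x = indLeft P Q x := by
  by_cases hP : P = 0
  · simp [indLeft, hP]
  by_cases hQ : Q = 0
  · simp [indLeft, hQ]
  simp only [indLeft, mul_ne_zero_iff, val_mul_left hh hP hQ, cofactorSign_mul_left hh, ne_eq, hh,
    hP, hQ, not_false_eq_true, true_and]

theorem indIncr_mul_left {h : R[X]} (hh : h ≠ 0) (P Q : R[X]) (a b : R) :
    indIncr (h * P) (h * Q) a b = indIncr P Q a b := by
  simp only [indIncr, indPt, indRight_mul_left hh, indLeft_mul_left hh]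

omit [LinearOrder R] [IsStrictOrderedRing R] in
theorem val_neg_iff {P Q : R[X]} {x : R} (hQ : Q ≠ 0)
    (h : ¬(P.eval x = 0 ∧ Q.eval x = 0)) : val P Q x < 0 ↔ Q.eval x = 0 := by
  rw [val]
  have hr := rootMultiplicity_pos hQ (x := x)
  rw [IsRoot] at hr
  by_cases hx : Q.eval x = 0
  · have h1 : P.rootMultiplicity x = 0 := rootMultiplicity_eq_zero fun hp => h ⟨hp, hx⟩
    have := hr.2 hx
    simp only [hx, iff_true]; omega
  · have : Q.rootMultiplicity x = 0 := rootMultiplicity_eq_zero hx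
    simp only [hx, iff_false]; omega

/-- Without a common zero at `x`, the poles of `P/Q` are the zeros of `Q`. The zero polynomial fits
the formula because its one-sided signs are 0. -/
theorem indRight_eq {P Q : R[X]} {x : R} (h : ¬(P.eval x = 0 ∧ Q.eval x = 0)) :
    indRight P Q x = if Q.eval x = 0 then 1 / 2 * ((signRight P x : ℚ) * signRight Q x) else 0 := by
  by_cases hP : P = 0
  · simp [indRight, hP]
  by_cases hQ : Q = 0
  · simp [indRight, hQ]
  simp only [indRight, ne_eq, hP, hQ, not_false_eq_true, true_and, val_neg_iff hQ h,
    cofactorSign_eq]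

theorem indLeft_eq {P Q : R[X]} {x : R} (h : ¬(P.eval x = 0 ∧ Q.eval x = 0)) :
    indLeft P Q x = if Q.eval x = 0 then 1 / 2 * ((signLeft P x : ℚ) * signLeft Q x) else 0 := by
  by_cases hP : P = 0
  · simp [indLeft, hP]
  by_cases hQ : Q = 0
  · simp [indLeft, hQ]
  simp only [indLeft, ne_eq, hP, hQ, not_false_eq_true, true_and, val_neg_iff hQ h,
    cofactorSign_eq]
  congr 1
  simp only [signLeft, SignType.coe_mul, SignType.coe_pow, SignType.coe_neg, SignType.coe_one, val]
  -- The parity of the valuation splits into the two factors that turn right-hand signs into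
  -- left-hand signs.
  have hpow : (-1 : ℚ) ^ ((P.rootMultiplicity x : ℤ) - Q.rootMultiplicity x) =
      (-1) ^ P.rootMultiplicity x * (-1) ^ Q.rootMultiplicity x := by
    rw [zpow_sub₀ (by norm_num), div_eq_mul_inv, ← inv_zpow, zpow_natCast, zpow_natCast,
      show (-1 : ℚ)⁻¹ = -1 by norm_num]
  rw [hpow]
  ring

omit [IsStrictOrderedRing R] in
theorem signLeft_eq_signRight_of_eval_ne_zero {p : R[X]} {x : R} (h : p.eval x ≠ 0) :
    signLeft p x = signRight p x := by
  rw [signLeft_of_eval_ne_zero h, signRight_of_eval_ne_zero h]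

theorem indPt_eq_zero {P Q : R[X]} {x : R} (h : Q = 0 ∨ Q.eval x ≠ 0) : indPt P Q x = 0 := by
  rcases h with rfl | h
  · simp [indPt, indRight, indLeft]
  · rw [indPt, indRight_eq (fun h' => h h'.2), indLeft_eq (fun h' => h h'.2)]
    simp [h]

theorem finite_support_indPt (P Q : R[X]) : (Function.support (indPt P Q)).Finite := by
  by_cases hQ : Q = 0
  · subst hQ
    convert Set.finite_empty
    ext x; simp [indPt_eq_zero]
  · refine Q.roots.toFinset.finite_toSet.subset fun x hx => ?_
    by_contra hx'
    exact hx (indPt_eq_zero (Or.inr fun h => hx' (by simp [hQ, h])))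

omit [IsStrictOrderedRing R] in
theorem finite_support_signJump (p : R[X]) :
    (Function.support fun x => (signRight p x : ℚ) - signLeft p x).Finite := by
  rcases eq_or_ne p 0 with rfl | hp
  · simp
  · refine p.roots.toFinset.finite_toSet.subset fun x hx => ?_
    by_contra hx'
    have : p.eval x ≠ 0 := fun h => hx' (by simp [hp, h])
    exact hx (by simp [signLeft_eq_signRight_of_eval_ne_zero this])

omit [Field R] [IsStrictOrderedRing R] in
theorem finsum_mem_Ioo_split {f : R → ℚ} (hf : f.support.Finite) {a b c : R}
    (hc : c ∈ Set.Ioo a b) :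
    ∑ᶠ x ∈ Set.Ioo a b, f x = ∑ᶠ x ∈ Set.Ioo a c, f x + f c + ∑ᶠ x ∈ Set.Ioo c b, f x := by
  rw [← Set.Ioc_union_Ioo_eq_Ioo hc.1.le hc.2, finsum_mem_union'
    (Set.disjoint_left.2 fun x hx hx' => hx.2.not_gt hx'.1)
    (hf.subset Set.inter_subset_right) (hf.subset Set.inter_subset_right),
    ← Set.Ioo_insert_right hc.1,
    finsum_mem_insert' _ Set.right_notMem_Ioo (hf.subset Set.inter_subset_right), add_comm (f c)]

variable [IsRealClosed R]

/-- Write `p = (X - a)^m * cofactor`: the power is positive to the right of `a`, and the cofactor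
has no root on `[a, y]`. -/
theorem sign_eq_signRight_of_forall {p : R[X]} {a b : R} (h : ∀ x ∈ Set.Ioo a b, p.eval x ≠ 0)
    {y : R} (hy : y ∈ Set.Ioo a b) : SignType.sign (p.eval y) = signRight p a := by
  have hp : p ≠ 0 := fun h0 => h y hy (by simp [h0])
  have he : ∀ x, p.eval x = (x - a) ^ p.rootMultiplicity a * (cofactor p a).eval x := fun x => by
    conv_lhs => rw [← pow_mul_cofactor p a]
    simp
  rw [he, sign_mul, sign_pos (pow_pos (sub_pos.2 hy.1) _), one_mul, signRight]
  refine (sign_eval_eq hy.1.le fun x hx => ?_).symm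
  rcases hx.1.eq_or_lt with rfl | hx'
  · exact eval_cofactor_ne_zero hp a
  · exact right_ne_zero_of_mul ((he x).symm.trans_ne (h x ⟨hx', hx.2.trans_lt hy.2⟩))

theorem sign_eq_signLeft_of_forall {p : R[X]} {a b : R} (h : ∀ x ∈ Set.Ioo a b, p.eval x ≠ 0)
    {y : R} (hy : y ∈ Set.Ioo a b) : SignType.sign (p.eval y) = signLeft p b := by
  have hp : p ≠ 0 := fun h0 => h y hy (by simp [h0])
  have he : ∀ x, p.eval x = (x - b) ^ p.rootMultiplicity b * (cofactor p b).eval x := fun x => by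
    conv_lhs => rw [← pow_mul_cofactor p b]
    simp
  rw [he, sign_mul, sign_pow, sign_neg (sub_neg.2 hy.2), signLeft, signRight]
  congr 1
  refine sign_eval_eq hy.2.le fun x hx => ?_
  rcases hx.2.eq_or_lt with rfl | hx'
  · exact eval_cofactor_ne_zero hp _
  · exact right_ne_zero_of_mul ((he x).symm.trans_ne (h x ⟨hy.1.trans_le hx.1, hx'⟩))

theorem exists_forall_sign_eq_signRight (p : R[X]) (x : R) :
    ∃ b > x, ∀ y ∈ Set.Ioo x b, SignType.sign (p.eval y) = signRight p x := by
  rcases eq_or_ne p 0 with rfl | hp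
  · exact ⟨x + 1, by simp, by simp⟩
  classical
  let s := p.roots.toFinset.filter (x < ·)
  obtain ⟨b, hb, hbs⟩ : ∃ b > x, ∀ r ∈ s, b ≤ r := by
    rcases s.eq_empty_or_nonempty with h | h
    · exact ⟨x + 1, by simp, by simp [h]⟩
    · exact ⟨s.min' h, (Finset.mem_filter.1 (s.min'_mem h)).2, fun r hr => s.min'_le r hr⟩
  refine ⟨b, hb, fun y hy => sign_eq_signRight_of_forall (fun z hz h0 => ?_) hy⟩
  exact absurd hz.2 (not_lt.2 (hbs z (by simp [s, hp, h0, hz.1])))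

theorem exists_forall_sign_eq_signLeft (p : R[X]) (x : R) :
    ∃ a < x, ∀ y ∈ Set.Ioo a x, SignType.sign (p.eval y) = signLeft p x := by
  rcases eq_or_ne p 0 with rfl | hp
  · exact ⟨x - 1, by simp, by simp⟩
  classical
  let s := p.roots.toFinset.filter (· < x)
  obtain ⟨b, hb, hbs⟩ : ∃ b < x, ∀ r ∈ s, r ≤ b := by
    rcases s.eq_empty_or_nonempty with h | h
    · exact ⟨x - 1, by simp, by simp [h]⟩
    · exact ⟨s.max' h, (Finset.mem_filter.1 (s.max'_mem h)).2, fun r hr => s.le_max' r hr⟩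
  refine ⟨b, hb, fun y hy => sign_eq_signLeft_of_forall (fun z hz h0 => ?_) hy⟩
  exact absurd hz.1 (not_lt.2 (hbs z (by simp [s, hp, h0, hz.2])))

/-- The sign is constant between consecutive roots, so its jumps telescope. The induction is on the
number of roots in `(a, b)`, cutting at one of them. -/
theorem signLeft_sub_signRight (p : R[X]) {a b : R} (hab : a < b) :
    (signLeft p b : ℚ) - signRight p a =
      ∑ᶠ x ∈ Set.Ioo a b, ((signRight p x : ℚ) - signLeft p x) := by
  classical
  rcases eq_or_ne p 0 with rfl | hp
  · simp
  induction hn : (p.roots.toFinset.filter (· ∈ Set.Ioo a b)).card using Nat.strong_induction_on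
    generalizing a b with
  | _ n ih =>
  subst hn
  by_cases hroot : ∃ c ∈ Set.Ioo a b, p.eval c = 0
  · obtain ⟨c, hc, hc0⟩ := hroot
    have h1 := ih _ (Finset.card_lt_card (by
      refine (Finset.ssubset_iff_of_subset (fun x hx => ?_)).2 ⟨c, ?_, ?_⟩
      · simp only [Finset.mem_filter, Set.mem_Ioo] at hx ⊢
        exact ⟨hx.1, hx.2.1, hx.2.2.trans hc.2⟩
      · simp [hp, hc0, hc.1, hc.2]
      · simp)) hc.1 rfl
    have h2 := ih _ (Finset.card_lt_card (by
      refine (Finset.ssubset_iff_of_subset (fun x hx => ?_)).2 ⟨c, ?_, ?_⟩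
      · simp only [Finset.mem_filter, Set.mem_Ioo] at hx ⊢
        exact ⟨hx.1, hc.1.trans hx.2.1, hx.2.2⟩
      · simp [hp, hc0, hc.1, hc.2]
      · simp)) hc.2 rfl
    rw [finsum_mem_Ioo_split (finite_support_signJump p) hc, ← h1, ← h2]
    ring
  · push Not at hroot
    obtain ⟨y, hy⟩ := exists_between hab
    rw [← sign_eq_signLeft_of_forall hroot hy, ← sign_eq_signRight_of_forall hroot hy,
      sub_self]
    refine (finsum_mem_eq_zero_of_forall_eq_zero fun x hx => ?_).symm
    rw [signLeft_eq_signRight_of_eval_ne_zero (hroot x hx), sub_self]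

end Germs

/-! ### The product formula for the Cauchy index -/

section Product

variable {R : Type*} [Field R] [LinearOrder R]

/-- The sign of an element of an ordered field, as a rational number. -/
def sgn (x : R) : ℚ := (SignType.sign x : SignType)

theorem sgn_zero : sgn (0 : R) = 0 := by simp [sgn]

theorem sgn_pos {x : R} (h : 0 < x) : sgn x = 1 := by simp [sgn, sign_pos h]

theorem sgn_neg_of_neg {x : R} (h : x < 0) : sgn x = -1 := by simp [sgn, sign_neg h]

variable [IsStrictOrderedRing R]

theorem sgn_mul (x y : R) : sgn (x * y) = sgn x * sgn y := by
  rw [sgn, sign_mul, SignType.coe_mul]; rfl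

omit [IsStrictOrderedRing R] in
theorem sgn_mul_self {x : R} (h : x ≠ 0) : sgn x * sgn x = 1 :=
  SignType.coe_mul_self (sign_ne_zero.2 h)

/-- If `a` and `b` have opposite signs, then `sgn a + sgn b = 0` and `sgn a * sgn b = -1`, so the
unknown sign on the left reappears on the right. In all other cases that sign is determined. -/
theorem sgn_linear_combination {a b α β : R} (hα : 0 < α) (hβ : 0 < β) :
    sgn (α * b + β * a) = sgn a + sgn b - sgn (α * b + β * a) * sgn a * sgn b := by
  rcases lt_trichotomy a 0 with ha | rfl | ha <;> rcases lt_trichotomy b 0 with hb | rfl | hb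
  · rw [sgn_neg_of_neg ha, sgn_neg_of_neg hb, sgn_neg_of_neg (x := α * b + β * a) (by nlinarith)]; ring
  · rw [mul_zero, zero_add, sgn_mul, sgn_zero, sgn_pos hβ]; ring
  · rw [sgn_neg_of_neg ha, sgn_pos hb]; ring
  · rw [mul_zero, add_zero, sgn_mul, sgn_zero, sgn_pos hα]; ring
  · simp [sgn_zero]
  · rw [mul_zero, add_zero, sgn_mul, sgn_zero, sgn_pos hα]; ring
  · rw [sgn_neg_of_neg hb, sgn_pos ha]; ring
  · rw [mul_zero, zero_add, sgn_mul, sgn_zero, sgn_pos hβ]; ring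
  · rw [sgn_pos ha, sgn_pos hb, sgn_pos (x := α * b + β * a) (by positivity)]; ring

/-- The product formula for the local Cauchy index. Small letters are values of polynomials at a
point, capital letters are their values at a nearby point on one side. -/
theorem index_mul_of_values {p₁ q₁ p₂ q₂ P₁ Q₁ P₂ Q₂ : R}
    (hP₁ : p₁ ≠ 0 → sgn P₁ = sgn p₁) (hQ₁ : q₁ ≠ 0 → sgn Q₁ = sgn q₁)
    (hP₂ : p₂ ≠ 0 → sgn P₂ = sgn p₂) (hQ₂ : q₂ ≠ 0 → sgn Q₂ = sgn q₂)
    (hP : p₁ * p₂ - q₁ * q₂ ≠ 0 → sgn (P₁ * P₂ - Q₁ * Q₂) = sgn (p₁ * p₂ - q₁ * q₂))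
    (hQ : p₁ * q₂ + q₁ * p₂ ≠ 0 → sgn (P₁ * Q₂ + Q₁ * P₂) = sgn (p₁ * q₂ + q₁ * p₂))
    (h₁ : ¬(p₁ = 0 ∧ q₁ = 0)) (h₂ : ¬(p₂ = 0 ∧ q₂ = 0)) :
    (if p₁ * q₂ + q₁ * p₂ = 0 then
        1 / 2 * (sgn (P₁ * P₂ - Q₁ * Q₂) * sgn (P₁ * Q₂ + Q₁ * P₂)) else 0) =
      (if q₁ = 0 then 1 / 2 * (sgn P₁ * sgn Q₁) else 0) +
      (if q₂ = 0 then 1 / 2 * (sgn P₂ * sgn Q₂) else 0) -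
      1 / 2 * (sgn (P₁ * Q₂ + Q₁ * P₂) * sgn Q₁ * sgn Q₂ -
        sgn (p₁ * q₂ + q₁ * p₂) * sgn q₁ * sgn q₂) := by
  by_cases hq₁ : q₁ = 0 <;> by_cases hq₂ : q₂ = 0
  -- Both factors may have a pole. Adding `Q₁/P₁` and `Q₂/P₂` and clearing denominators by squares
  -- reduces this to `sgn_linear_combination`.
  · subst hq₁ hq₂
    have hp₁ : p₁ ≠ 0 := fun h => h₁ ⟨h, rfl⟩
    have hp₂ : p₂ ≠ 0 := fun h => h₂ ⟨h, rfl⟩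
    have hP₁0 : P₁ ≠ 0 := by
      rintro rfl
      have := sgn_mul_self hp₁
      rw [← hP₁ hp₁, sgn_zero] at this; simp at this
    have hP₂0 : P₂ ≠ 0 := by
      rintro rfl
      have := sgn_mul_self hp₂
      rw [← hP₂ hp₂, sgn_zero] at this; simp at this
    have key := sgn_linear_combination (a := P₁ * Q₁) (b := P₂ * Q₂) (α := P₁ ^ 2) (β := P₂ ^ 2)
      (by positivity) (by positivity)
    rw [show P₁ ^ 2 * (P₂ * Q₂) + P₂ ^ 2 * (P₁ * Q₁) = P₁ * P₂ * (P₁ * Q₂ + Q₁ * P₂) by ring] at key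
    simp only [sgn_mul] at key
    simp only [mul_zero, zero_mul, sub_zero, add_zero, if_true, sgn_zero] at hP ⊢
    rw [hP (mul_ne_zero hp₁ hp₂), sgn_mul, ← hP₁ hp₁, ← hP₂ hp₂]
    have e1 := sgn_mul_self hP₁0
    have e2 := sgn_mul_self hP₂0
    linear_combination (1 / 2 : ℚ) * key - (1 / 2 : ℚ) * sgn (P₁ * Q₂ + Q₁ * P₂) * sgn Q₁ * sgn Q₂ *
      (sgn P₂ * sgn P₂ * e1 + e2)
  · subst hq₁
    have hp₁ : p₁ ≠ 0 := fun h => h₁ ⟨h, rfl⟩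
    have h12 : p₁ * q₂ ≠ 0 := mul_ne_zero hp₁ hq₂
    simp only [zero_mul, add_zero, if_true, hq₂, if_false, sgn_zero, h12] at hQ ⊢
    rw [hQ (mul_ne_zero hp₁ hq₂), sgn_mul, hP₁ hp₁, hQ₂ hq₂]
    linear_combination (1 / 2 : ℚ) * sgn p₁ * sgn Q₁ * sgn_mul_self hq₂
  · subst hq₂
    have hp₂ : p₂ ≠ 0 := fun h => h₂ ⟨h, rfl⟩
    have h12 : q₁ * p₂ ≠ 0 := mul_ne_zero hq₁ hp₂
    simp only [mul_zero, zero_add, if_true, hq₁, if_false, sgn_zero, h12] at hQ ⊢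
    rw [hQ (mul_ne_zero hq₁ hp₂), sgn_mul, hP₂ hp₂, hQ₁ hq₁]
    linear_combination (1 / 2 : ℚ) * sgn p₂ * sgn Q₂ * sgn_mul_self hq₁
  · simp only [hq₁, hq₂, if_false]
    by_cases h12 : p₁ * q₂ + q₁ * p₂ = 0
    -- The product has a pole that neither factor has: `p₁ q₂ = -q₁ p₂` fixes the sign of its real
    -- part, so only the correction term contributes.
    · have hneg : (p₁ * p₂ - q₁ * q₂) * (q₁ * q₂) < 0 := by
        have : (p₁ * p₂ - q₁ * q₂) * (q₁ * q₂) = -((p₁ * q₂) ^ 2 + (q₁ * q₂) ^ 2) := by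
          linear_combination p₁ * q₂ * h12
        rw [this, neg_lt_zero]
        have := mul_ne_zero hq₁ hq₂
        positivity
      have hs := sgn_neg_of_neg hneg
      rw [sgn_mul, sgn_mul q₁] at hs
      rw [if_pos h12, hP (left_ne_zero_of_mul hneg.ne), hQ₁ hq₁, hQ₂ hq₂, h12, sgn_zero]
      have e1 := sgn_mul_self hq₁
      have e2 := sgn_mul_self hq₂
      set D := sgn (P₁ * Q₂ + Q₁ * P₂)
      set N := sgn (p₁ * p₂ - q₁ * q₂)
      linear_combination (1 / 2 : ℚ) * D * sgn q₁ * sgn q₂ * hs -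
        (1 / 2 : ℚ) * D * N * (sgn q₂ * sgn q₂ * e1 + e2)
    · rw [if_neg h12, hQ h12, hQ₁ hq₁, hQ₂ hq₂]; ring

/-- The imaginary parts of two complex numbers and of their product, multiplied. -/
def imProd (p₁ q₁ p₂ q₂ : R[X]) : R[X] := (p₁ * q₂ + q₁ * p₂) * q₁ * q₂

variable [IsRealClosed R]

theorem indRight_mul {p₁ q₁ p₂ q₂ : R[X]} {x : R} (h₁ : ¬(p₁.eval x = 0 ∧ q₁.eval x = 0))
    (h₂ : ¬(p₂.eval x = 0 ∧ q₂.eval x = 0))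
    (h : ¬((p₁ * p₂ - q₁ * q₂).eval x = 0 ∧ (p₁ * q₂ + q₁ * p₂).eval x = 0)) :
    indRight (p₁ * p₂ - q₁ * q₂) (p₁ * q₂ + q₁ * p₂) x = indRight p₁ q₁ x + indRight p₂ q₂ x -
      1 / 2 * (signRight (imProd p₁ q₁ p₂ q₂) x - sgn ((imProd p₁ q₁ p₂ q₂).eval x)) := by
  obtain ⟨b₁, hb₁, H₁⟩ := exists_forall_sign_eq_signRight p₁ x
  obtain ⟨b₂, hb₂, H₂⟩ := exists_forall_sign_eq_signRight q₁ x
  obtain ⟨b₃, hb₃, H₃⟩ := exists_forall_sign_eq_signRight p₂ x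
  obtain ⟨b₄, hb₄, H₄⟩ := exists_forall_sign_eq_signRight q₂ x
  obtain ⟨b₅, hb₅, H₅⟩ := exists_forall_sign_eq_signRight (p₁ * p₂ - q₁ * q₂) x
  obtain ⟨b₆, hb₆, H₆⟩ := exists_forall_sign_eq_signRight (p₁ * q₂ + q₁ * p₂) x
  -- One point `y` so close to `x` that all six polynomials show their right-hand sign there.
  obtain ⟨y, hxy, hy⟩ := exists_between (a₁ := x)
    (a₂ := min b₁ (min b₂ (min b₃ (min b₄ (min b₅ b₆))))) (by simp [*])
  simp only [lt_min_iff] at hy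
  obtain ⟨hy₁, hy₂, hy₃, hy₄, hy₅, hy₆⟩ := hy
  have H₁ := H₁ y ⟨hxy, hy₁⟩
  have H₂ := H₂ y ⟨hxy, hy₂⟩
  have H₃ := H₃ y ⟨hxy, hy₃⟩
  have H₄ := H₄ y ⟨hxy, hy₄⟩
  have H₅ := H₅ y ⟨hxy, hy₅⟩
  have H₆ := H₆ y ⟨hxy, hy₆⟩
  rw [indRight_eq h₁, indRight_eq h₂, indRight_eq h, imProd, signRight_mul, signRight_mul, ← H₁, ← H₂,
    ← H₃, ← H₄, ← H₅, ← H₆]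
  have key := index_mul_of_values (p₁ := p₁.eval x) (q₁ := q₁.eval x) (p₂ := p₂.eval x)
    (q₂ := q₂.eval x) (P₁ := p₁.eval y) (Q₁ := q₁.eval y) (P₂ := p₂.eval y) (Q₂ := q₂.eval y)
    (fun h => by rw [sgn, H₁, signRight_of_eval_ne_zero h]; rfl)
    (fun h => by rw [sgn, H₂, signRight_of_eval_ne_zero h]; rfl)
    (fun h => by rw [sgn, H₃, signRight_of_eval_ne_zero h]; rfl)
    (fun h => by rw [sgn, H₄, signRight_of_eval_ne_zero h]; rfl)
    (fun h => by
      simp only [← eval_mul, ← eval_sub] at h ⊢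
      rw [sgn, H₅, signRight_of_eval_ne_zero h]; rfl)
    (fun h => by
      simp only [← eval_mul, ← eval_add] at h ⊢
      rw [sgn, H₆, signRight_of_eval_ne_zero h]; rfl) h₁ h₂
  simp only [eval_add, eval_sub, eval_mul, SignType.coe_mul, sgn_mul] at key ⊢
  exact key

theorem indLeft_mul {p₁ q₁ p₂ q₂ : R[X]} {x : R} (h₁ : ¬(p₁.eval x = 0 ∧ q₁.eval x = 0))
    (h₂ : ¬(p₂.eval x = 0 ∧ q₂.eval x = 0))
    (h : ¬((p₁ * p₂ - q₁ * q₂).eval x = 0 ∧ (p₁ * q₂ + q₁ * p₂).eval x = 0)) :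
    indLeft (p₁ * p₂ - q₁ * q₂) (p₁ * q₂ + q₁ * p₂) x = indLeft p₁ q₁ x + indLeft p₂ q₂ x -
      1 / 2 * (signLeft (imProd p₁ q₁ p₂ q₂) x - sgn ((imProd p₁ q₁ p₂ q₂).eval x)) := by
  obtain ⟨b₁, hb₁, H₁⟩ := exists_forall_sign_eq_signLeft p₁ x
  obtain ⟨b₂, hb₂, H₂⟩ := exists_forall_sign_eq_signLeft q₁ x
  obtain ⟨b₃, hb₃, H₃⟩ := exists_forall_sign_eq_signLeft p₂ x
  obtain ⟨b₄, hb₄, H₄⟩ := exists_forall_sign_eq_signLeft q₂ x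
  obtain ⟨b₅, hb₅, H₅⟩ := exists_forall_sign_eq_signLeft (p₁ * p₂ - q₁ * q₂) x
  obtain ⟨b₆, hb₆, H₆⟩ := exists_forall_sign_eq_signLeft (p₁ * q₂ + q₁ * p₂) x
  obtain ⟨y, hy, hxy⟩ := exists_between (a₂ := x)
    (a₁ := max b₁ (max b₂ (max b₃ (max b₄ (max b₅ b₆))))) (by simp [*])
  simp only [max_lt_iff] at hy
  obtain ⟨hy₁, hy₂, hy₃, hy₄, hy₅, hy₆⟩ := hy
  have H₁ := H₁ y ⟨hy₁, hxy⟩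
  have H₂ := H₂ y ⟨hy₂, hxy⟩
  have H₃ := H₃ y ⟨hy₃, hxy⟩
  have H₄ := H₄ y ⟨hy₄, hxy⟩
  have H₅ := H₅ y ⟨hy₅, hxy⟩
  have H₆ := H₆ y ⟨hy₆, hxy⟩
  rw [indLeft_eq h₁, indLeft_eq h₂, indLeft_eq h, imProd, signLeft_mul, signLeft_mul, ← H₁, ← H₂,
    ← H₃, ← H₄, ← H₅, ← H₆]
  have key := index_mul_of_values (p₁ := p₁.eval x) (q₁ := q₁.eval x) (p₂ := p₂.eval x)
    (q₂ := q₂.eval x) (P₁ := p₁.eval y) (Q₁ := q₁.eval y) (P₂ := p₂.eval y) (Q₂ := q₂.eval y)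
    (fun h => by rw [sgn, H₁, signLeft_of_eval_ne_zero h]; rfl)
    (fun h => by rw [sgn, H₂, signLeft_of_eval_ne_zero h]; rfl)
    (fun h => by rw [sgn, H₃, signLeft_of_eval_ne_zero h]; rfl)
    (fun h => by rw [sgn, H₄, signLeft_of_eval_ne_zero h]; rfl)
    (fun h => by
      simp only [← eval_mul, ← eval_sub] at h ⊢
      rw [sgn, H₅, signLeft_of_eval_ne_zero h]; rfl)
    (fun h => by
      simp only [← eval_mul, ← eval_add] at h ⊢
      rw [sgn, H₆, signLeft_of_eval_ne_zero h]; rfl) h₁ h₂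
  simp only [eval_add, eval_sub, eval_mul, SignType.coe_mul, sgn_mul] at key ⊢
  exact key

omit [IsRealClosed R] in
theorem mul_ne_zero_of_parts {p₁ q₁ p₂ q₂ : R} (h₁ : ¬(p₁ = 0 ∧ q₁ = 0))
    (h₂ : ¬(p₂ = 0 ∧ q₂ = 0)) : ¬(p₁ * p₂ - q₁ * q₂ = 0 ∧ p₁ * q₂ + q₁ * p₂ = 0) := by
  rintro ⟨ha, hb⟩
  have h : (p₁ ^ 2 + q₁ ^ 2) * (p₂ ^ 2 + q₂ ^ 2) = 0 := by
    linear_combination (p₁ * p₂ - q₁ * q₂) * ha + (p₁ * q₂ + q₁ * p₂) * hb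
  rcases mul_eq_zero.1 h with h | h
  · exact h₁ ⟨by nlinarith [sq_nonneg p₁, sq_nonneg q₁], by nlinarith [sq_nonneg p₁, sq_nonneg q₁]⟩
  · exact h₂ ⟨by nlinarith [sq_nonneg p₂, sq_nonneg q₂], by nlinarith [sq_nonneg p₂, sq_nonneg q₂]⟩

/-- In the local formulas the value of `imProd` at an interior point cancels between right and left,
leaving the jump of its sign. The jumps telescope, so only the signs at `a` and `b` survive. -/
theorem indIncr_mul_of_forall {p₁ q₁ p₂ q₂ : R[X]} (h₁ : ∀ x, ¬(p₁.eval x = 0 ∧ q₁.eval x = 0))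
    (h₂ : ∀ x, ¬(p₂.eval x = 0 ∧ q₂.eval x = 0)) {a b : R} (hab : a < b) :
    indIncr (p₁ * p₂ - q₁ * q₂) (p₁ * q₂ + q₁ * p₂) a b = indIncr p₁ q₁ a b + indIncr p₂ q₂ a b -
      1 / 2 * (sgn ((imProd p₁ q₁ p₂ q₂).eval b) - sgn ((imProd p₁ q₁ p₂ q₂).eval a)) := by
  have h : ∀ x, ¬((p₁ * p₂ - q₁ * q₂).eval x = 0 ∧ (p₁ * q₂ + q₁ * p₂).eval x = 0) := fun x => by
    simpa only [eval_add, eval_sub, eval_mul] using mul_ne_zero_of_parts (h₁ x) (h₂ x)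
  have hpt : ∀ x, indPt (p₁ * p₂ - q₁ * q₂) (p₁ * q₂ + q₁ * p₂) x +
      1 / 2 * ((signRight (imProd p₁ q₁ p₂ q₂) x : ℚ) - signLeft (imProd p₁ q₁ p₂ q₂) x) =
      indPt p₁ q₁ x + indPt p₂ q₂ x := fun x => by
    rw [indPt, indRight_mul (h₁ x) (h₂ x) (h x), indLeft_mul (h₁ x) (h₂ x) (h x), indPt, indPt]
    ring
  have hjump := finite_support_signJump (imProd p₁ q₁ p₂ q₂)
  have hsum := finsum_mem_congr (s := Set.Ioo a b) rfl fun x _ => hpt x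
  rw [finsum_mem_add_distrib' ((finite_support_indPt _ _).subset Set.inter_subset_right)
      ((hjump.subset fun x hx => right_ne_zero_of_mul hx).subset Set.inter_subset_right),
    finsum_mem_add_distrib' ((finite_support_indPt _ _).subset Set.inter_subset_right)
      ((finite_support_indPt _ _).subset Set.inter_subset_right),
    ← mul_finsum_mem
      (fun x => (signRight (imProd p₁ q₁ p₂ q₂) x : ℚ) - signLeft (imProd p₁ q₁ p₂ q₂) x), ← signLeft_sub_signRight _ hab] at hsum
  rw [indIncr, indIncr, indIncr, indRight_mul (h₁ a) (h₂ a) (h a), indLeft_mul (h₁ b) (h₂ b) (h b)]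
  linear_combination hsum

omit [LinearOrder R] [IsStrictOrderedRing R] [IsRealClosed R] in
theorem exists_eq_mul_forall_ne {p q : R[X]} (h : ¬(p = 0 ∧ q = 0)) :
    ∃ g p' q' : R[X], g ≠ 0 ∧ p = g * p' ∧ q = g * q' ∧
      ∀ x, ¬(p'.eval x = 0 ∧ q'.eval x = 0) := by
  classical
  have hg : EuclideanDomain.gcd p q ≠ 0 := fun h0 => h (EuclideanDomain.gcd_eq_zero_iff.1 h0)
  obtain ⟨p', hp'⟩ := EuclideanDomain.gcd_dvd_left p q
  obtain ⟨q', hq'⟩ := EuclideanDomain.gcd_dvd_right p q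
  refine ⟨EuclideanDomain.gcd p q, p', q', hg, hp', hq', fun x hx => ?_⟩
  have hb := EuclideanDomain.gcd_eq_gcd_ab p q
  have h1 : 1 = p' * EuclideanDomain.gcdA p q + q' * EuclideanDomain.gcdB p q := by
    refine mul_left_cancel₀ hg ?_
    nth_rewrite 1 [mul_one, hb]
    nth_rewrite 1 [hp']
    nth_rewrite 3 [hq']
    ring
  have := congrArg (eval x) h1
  simp [hx.1, hx.2] at this

/-- The product formula for the Cauchy index. -/
theorem indIncr_mul {p₁ q₁ p₂ q₂ : R[X]} {a b : R} (hab : a < b)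
    (ha₁ : ¬(p₁.eval a = 0 ∧ q₁.eval a = 0)) (hb₁ : ¬(p₁.eval b = 0 ∧ q₁.eval b = 0))
    (ha₂ : ¬(p₂.eval a = 0 ∧ q₂.eval a = 0)) (hb₂ : ¬(p₂.eval b = 0 ∧ q₂.eval b = 0)) :
    indIncr (p₁ * p₂ - q₁ * q₂) (p₁ * q₂ + q₁ * p₂) a b = indIncr p₁ q₁ a b + indIncr p₂ q₂ a b -
      1 / 2 * (sgn ((imProd p₁ q₁ p₂ q₂).eval b) - sgn ((imProd p₁ q₁ p₂ q₂).eval a)) := by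
  -- Common zeros inside `(a, b)` are allowed; dividing by the gcds removes them without changing
  -- any index.
  obtain ⟨g₁, p₁', q₁', hg₁, rfl, rfl, h₁⟩ := exists_eq_mul_forall_ne (p := p₁) (q := q₁)
    (fun h => ha₁ (by simp [h.1, h.2]))
  obtain ⟨g₂, p₂', q₂', hg₂, rfl, rfl, h₂⟩ := exists_eq_mul_forall_ne (p := p₂) (q := q₂)
    (fun h => ha₂ (by simp [h.1, h.2]))
  have hs : ∀ x, ¬((g₁ * p₁').eval x = 0 ∧ (g₁ * q₁').eval x = 0) →
      ¬((g₂ * p₂').eval x = 0 ∧ (g₂ * q₂').eval x = 0) →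
      sgn ((imProd (g₁ * p₁') (g₁ * q₁') (g₂ * p₂') (g₂ * q₂')).eval x) =
        sgn ((imProd p₁' q₁' p₂' q₂').eval x) := fun x hx₁ hx₂ => by
    have e₁ : g₁.eval x ≠ 0 := fun h => hx₁ (by simp [h])
    have e₂ : g₂.eval x ≠ 0 := fun h => hx₂ (by simp [h])
    -- The gcds enter `imProd` as a square, positive where neither pair vanishes, so the endpoint
    -- signs are unchanged.
    have : (imProd (g₁ * p₁') (g₁ * q₁') (g₂ * p₂') (g₂ * q₂')).eval x =
        (g₁.eval x * g₂.eval x) ^ 2 * (imProd p₁' q₁' p₂' q₂').eval x := by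
      simp only [imProd, eval_mul, eval_add]; ring
    rw [this, sgn_mul, sgn_pos (by positivity), one_mul]
  rw [hs a ha₁ ha₂, hs b hb₁ hb₂, indIncr_mul_left hg₁, indIncr_mul_left hg₂,
    ← indIncr_mul_of_forall h₁ h₂ hab, ← indIncr_mul_left (mul_ne_zero hg₁ hg₂) (p₁' * p₂' - q₁' * q₂')]
  congr 1 <;> ring

end Product

/-! ### Real and imaginary parts of bivariate polynomials -/

section Parts

variable {R : Type*} [Field R]

/-- The polynomial `A + i B` with real part `A` and imaginary part `B`. -/
def ofParts (A B : MvPolynomial (Fin 2) R) : MvPolynomial (Fin 2) (Cplx R) :=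
  MvPolynomial.map (algebraMap R (Cplx R)) A +
    MvPolynomial.C I * MvPolynomial.map (algebraMap R (Cplx R)) B

@[simp] theorem rePart_ofParts (A B : MvPolynomial (Fin 2) R) : rePart (ofParts A B) = A := by
  ext m
  simp [coeff_rePart, ofParts, MvPolynomial.coeff_map, I]

@[simp] theorem imPart_ofParts (A B : MvPolynomial (Fin 2) R) : imPart (ofParts A B) = B := by
  ext m
  simp [coeff_imPart, ofParts, MvPolynomial.coeff_map, I]

theorem ofParts_rePart_imPart (F : MvPolynomial (Fin 2) (Cplx R)) :
    ofParts (rePart F) (imPart F) = F := by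
  ext m <;>
  simp [coeff_rePart, coeff_imPart, ofParts, MvPolynomial.coeff_map, I]

theorem ofParts_mul (A B A' B' : MvPolynomial (Fin 2) R) :
    ofParts A B * ofParts A' B' = ofParts (A * A' - B * B') (A * B' + B * A') := by
  have hI : (MvPolynomial.C I : MvPolynomial (Fin 2) (Cplx R)) * MvPolynomial.C I = -1 := by
    rw [← MvPolynomial.C_mul, show (I : Cplx R) * I = -1 by ext <;> simp [I, QuadraticAlgebra.re_one, QuadraticAlgebra.im_one], MvPolynomial.C_neg,
      MvPolynomial.C_1]
  simp only [ofParts, map_sub, map_add, map_mul]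
  linear_combination MvPolynomial.map (algebraMap R (Cplx R)) B *
    MvPolynomial.map (algebraMap R (Cplx R)) B' * hI

theorem rePart_mul (F G : MvPolynomial (Fin 2) (Cplx R)) :
    rePart (F * G) = rePart F * rePart G - imPart F * imPart G := by
  conv_lhs => rw [← ofParts_rePart_imPart F, ← ofParts_rePart_imPart G, ofParts_mul, rePart_ofParts]

theorem imPart_mul (F G : MvPolynomial (Fin 2) (Cplx R)) :
    imPart (F * G) = rePart F * imPart G + imPart F * rePart G := by
  conv_lhs => rw [← ofParts_rePart_imPart F, ← ofParts_rePart_imPart G, ofParts_mul, imPart_ofParts]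

theorem rePart_conj (F : MvPolynomial (Fin 2) (Cplx R)) : rePart (conj F) = rePart F := by
  ext m
  simp [coeff_rePart, conj, MvPolynomial.coeff_map, starRingEnd_apply]

theorem imPart_conj (F : MvPolynomial (Fin 2) (Cplx R)) : imPart (conj F) = -imPart F := by
  ext m
  simp [coeff_imPart, conj, MvPolynomial.coeff_map, starRingEnd_apply]

theorem toXY_C (c : Cplx R) :
    toXY (C c) = ofParts (MvPolynomial.C c.re) (MvPolynomial.C c.im) := by
  rw [toXY, aeval_C, MvPolynomial.algebraMap_eq, ofParts, MvPolynomial.map_C, MvPolynomial.map_C,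
    ← MvPolynomial.C_mul, ← MvPolynomial.C_add]
  congr 1
  ext <;> simp [I]

theorem toXY_X_sub_C (z : Cplx R) : toXY (X - C z) =
    ofParts (MvPolynomial.X 0 - MvPolynomial.C z.re) (MvPolynomial.X 1 - MvPolynomial.C z.im) := by
  have h := toXY_C z
  rw [toXY] at h ⊢
  rw [map_sub, h, aeval_X, ofParts, ofParts, map_sub, map_sub, MvPolynomial.map_X, MvPolynomial.map_X]
  ring

theorem toXY_mul (F G : (Cplx R)[X]) : toXY (F * G) = toXY F * toXY G := by
  simp only [toXY, map_mul]

theorem conj_mul (F G : MvPolynomial (Fin 2) (Cplx R)) : conj (F * G) = conj F * conj G := by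
  simp only [conj, map_mul]

theorem eval_restrictHoriz (H : MvPolynomial (Fin 2) R) (x y : R) :
    (restrictHoriz H y).eval x = MvPolynomial.eval ![x, y] H := by
  rw [restrictHoriz, ← coe_evalRingHom, ← RingHom.coe_coe (MvPolynomial.aeval _),
    ← RingHom.comp_apply]
  congr 1
  ext i
  · simp
  · fin_cases i <;> simp

theorem eval_restrictVert (H : MvPolynomial (Fin 2) R) (x y : R) :
    (restrictVert H x).eval y = MvPolynomial.eval ![x, y] H := by
  rw [restrictVert, ← coe_evalRingHom, ← RingHom.coe_coe (MvPolynomial.aeval _),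
    ← RingHom.comp_apply]
  congr 1
  ext i
  · simp
  · fin_cases i <;> simp

end Parts

/-! ### Cauchy indices of constants, negatives and linear polynomials -/

section Index

variable {R : Type*} [Field R] [LinearOrder R]

theorem indIncr_const_right (P : R[X]) (c a b : R) : indIncr P (C c) a b = 0 := by
  have h : ∀ x, ¬ (P ≠ 0 ∧ (C c : R[X]) ≠ 0 ∧ val P (C c) x < 0) := fun x h => by
    have := h.2.2
    rw [val, rootMultiplicity_C] at this
    omega
  simp only [indIncr, indPt, indRight, indLeft, if_neg (h _), sub_zero, finsum_zero, add_zero]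

variable [IsStrictOrderedRing R]

theorem signRight_neg (p : R[X]) (x : R) : signRight (-p) x = -signRight p x := by
  rw [show -p = C (-1) * p by simp, signRight_mul,
    signRight_of_eval_ne_zero (p := C (-1)) (by simp)]
  simp

omit [LinearOrder R] [IsStrictOrderedRing R] in
theorem rootMultiplicity_neg (p : R[X]) (x : R) :
    (-p).rootMultiplicity x = p.rootMultiplicity x := by
  rcases eq_or_ne p 0 with rfl | hp
  · simp
  rw [show -p = C (-1) * p by simp, rootMultiplicity_mul (mul_ne_zero (by simp) hp),
    rootMultiplicity_C, zero_add]

theorem indRight_neg_right (P Q : R[X]) (x : R) : indRight P (-Q) x = -indRight P Q x := by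
  simp only [indRight, val, cofactorSign_eq, signRight_neg, neg_ne_zero, rootMultiplicity_neg,
    SignType.coe_neg]
  split_ifs <;> ring

theorem indLeft_neg_right (P Q : R[X]) (x : R) : indLeft P (-Q) x = -indLeft P Q x := by
  simp only [indLeft, val, cofactorSign_eq, signRight_neg, neg_ne_zero, rootMultiplicity_neg,
    SignType.coe_neg]
  split_ifs <;> ring

theorem indIncr_neg_right (P Q : R[X]) (a b : R) : indIncr P (-Q) a b = -indIncr P Q a b := by
  have : ∀ x, indPt P (-Q) x = -indPt P Q x := fun x => by
    rw [indPt, indPt, indRight_neg_right, indLeft_neg_right]; ring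
  simp only [indIncr, this, indRight_neg_right, indLeft_neg_right, finsum_neg_distrib]
  ring

theorem signRight_X_sub_C (t : R) : signRight (X - C t) t = 1 := by
  have h := pow_mul_cofactor (X - C t) t
  rw [rootMultiplicity_X_sub_C_self, pow_one] at h
  have h1 : cofactor (X - C t) t = 1 := mul_left_cancel₀ (X_sub_C_ne_zero t) (by rw [h, mul_one])
  simp [signRight, h1]

theorem signLeft_X_sub_C (t : R) : signLeft (X - C t) t = -1 := by
  rw [signLeft, signRight_X_sub_C, rootMultiplicity_X_sub_C_self]; simp

theorem indRight_C_X_sub_C (c t x : R) :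
    indRight (C c) (X - C t) x = if x = t then 1 / 2 * sgn c else 0 := by
  by_cases hc : c = 0
  · simp [hc, indRight, sgn_zero]
  rw [indRight_eq (by simp [hc])]
  simp only [eval_sub, eval_X, eval_C, sub_eq_zero]
  split_ifs with h
  · subst h
    rw [signRight_X_sub_C, signRight_of_eval_ne_zero (by simpa using hc)]
    simp [sgn]
  · rfl

theorem indLeft_C_X_sub_C (c t x : R) :
    indLeft (C c) (X - C t) x = if x = t then -(1 / 2 * sgn c) else 0 := by
  by_cases hc : c = 0
  · simp [hc, indLeft, sgn_zero]
  rw [indLeft_eq (by simp [hc])]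
  simp only [eval_sub, eval_X, eval_C, sub_eq_zero]
  split_ifs with h
  · subst h
    rw [signLeft_X_sub_C, signLeft_of_eval_ne_zero (by simpa using hc)]
    simp [sgn]
  · rfl

theorem indIncr_C_X_sub_C (c t a b : R) : indIncr (C c) (X - C t) a b =
    sgn c * ((if a = t then 1 / 2 else 0) + (if t ∈ Set.Ioo a b then 1 else 0) +
      (if b = t then 1 / 2 else 0)) := by
  have h : ∑ᶠ x ∈ Set.Ioo a b, indPt (C c) (X - C t) x =
      if t ∈ Set.Ioo a b then sgn c else 0 := by
    rw [finsum_eq_single _ t]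
    · rw [finsum_eq_if, indPt, indRight_C_X_sub_C, indLeft_C_X_sub_C]
      simp only [if_true]
      congr 1; ring
    · intro x hx
      simp [indPt, indRight_C_X_sub_C, indLeft_C_X_sub_C, hx]
  rw [indIncr, h, indRight_C_X_sub_C, indLeft_C_X_sub_C]
  split_ifs <;> ring

/-- The bracket is the one in `indIncr_C_X_sub_C`: 1 inside, 1/2 at an end, 0 outside. Horizontal
and vertical positions of a zero are thus measured alike. -/
theorem sgn_sub_sgn {a b t : R} (hab : a < b) : sgn (b - t) - sgn (a - t) =
    2 * ((if a = t then 1 / 2 else 0) + (if t ∈ Set.Ioo a b then 1 else 0) +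
      (if b = t then 1 / 2 else 0)) := by
  rcases lt_trichotomy a t with h | rfl | h
  · rcases lt_trichotomy b t with h' | rfl | h'
    · rw [sgn_neg_of_neg (sub_neg.2 h), sgn_neg_of_neg (sub_neg.2 h')]
      simp [h.ne, h'.ne, h'.le]
    · rw [sgn_neg_of_neg (sub_neg.2 h), sub_self, sgn_zero]
      simp [h.ne]
    · rw [sgn_neg_of_neg (sub_neg.2 h), sgn_pos (sub_pos.2 h')]
      simp only [h.ne, h'.ne', Set.mem_Ioo, h, h', and_self, if_true, if_false]; norm_num
  · rw [sub_self, sgn_zero, sgn_pos (sub_pos.2 hab)]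
    simp [hab.ne']
  · rw [sgn_pos (sub_pos.2 h), sgn_pos (sub_pos.2 (h.trans hab))]
    simp [h.ne', (h.trans hab).ne', h.not_gt]

end Index

/-! ### Additivity of the winding number and its value on linear factors -/

section Winding

variable {R : Type*} [Field R] [LinearOrder R]

theorem windingNumber_eq (F : MvPolynomial (Fin 2) (Cplx R)) (Γ : Rectangle R) :
    windingNumber F Γ = 1 / 2 *
      (indIncr (restrictHoriz (rePart F) Γ.y₀) (restrictHoriz (imPart F) Γ.y₀) Γ.x₀ Γ.x₁
      + indIncr (restrictVert (rePart F) Γ.x₁) (restrictVert (imPart F) Γ.x₁) Γ.y₀ Γ.y₁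
      - indIncr (restrictHoriz (rePart F) Γ.y₁) (restrictHoriz (imPart F) Γ.y₁) Γ.x₀ Γ.x₁
      - indIncr (restrictVert (rePart F) Γ.x₀) (restrictVert (imPart F) Γ.x₀) Γ.y₀ Γ.y₁) := by
  simp only [windingNumber, cauchyIndex, Γ.hx, Γ.hy, Γ.hx.not_gt, Γ.hy.not_gt, if_true, if_false]
  ring

/-- `F` vanishes at no vertex of `Γ`. -/
def NonvanishingAtVertices (F : MvPolynomial (Fin 2) (Cplx R)) (Γ : Rectangle R) : Prop :=
  ∀ x y, (x = Γ.x₀ ∨ x = Γ.x₁) → (y = Γ.y₀ ∨ y = Γ.y₁) →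
    ¬(MvPolynomial.eval ![x, y] (rePart F) = 0 ∧ MvPolynomial.eval ![x, y] (imPart F) = 0)

omit [LinearOrder R] in
theorem restrictHoriz_rePart_mul (F G : MvPolynomial (Fin 2) (Cplx R)) (y : R) :
    restrictHoriz (rePart (F * G)) y = restrictHoriz (rePart F) y * restrictHoriz (rePart G) y -
      restrictHoriz (imPart F) y * restrictHoriz (imPart G) y := by
  simp only [restrictHoriz, rePart_mul, map_sub, map_mul]

omit [LinearOrder R] in
theorem restrictHoriz_imPart_mul (F G : MvPolynomial (Fin 2) (Cplx R)) (y : R) :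
    restrictHoriz (imPart (F * G)) y = restrictHoriz (rePart F) y * restrictHoriz (imPart G) y +
      restrictHoriz (imPart F) y * restrictHoriz (rePart G) y := by
  simp only [restrictHoriz, imPart_mul, map_add, map_mul]

omit [LinearOrder R] in
theorem restrictVert_rePart_mul (F G : MvPolynomial (Fin 2) (Cplx R)) (x : R) :
    restrictVert (rePart (F * G)) x = restrictVert (rePart F) x * restrictVert (rePart G) x -
      restrictVert (imPart F) x * restrictVert (imPart G) x := by
  simp only [restrictVert, rePart_mul, map_sub, map_mul]

omit [LinearOrder R] in
theorem restrictVert_imPart_mul (F G : MvPolynomial (Fin 2) (Cplx R)) (x : R) :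
    restrictVert (imPart (F * G)) x = restrictVert (rePart F) x * restrictVert (imPart G) x +
      restrictVert (imPart F) x * restrictVert (rePart G) x := by
  simp only [restrictVert, imPart_mul, map_add, map_mul]

variable [IsStrictOrderedRing R]

theorem NonvanishingAtVertices.mul {F G : MvPolynomial (Fin 2) (Cplx R)} {Γ : Rectangle R}
    (hF : NonvanishingAtVertices F Γ) (hG : NonvanishingAtVertices G Γ) :
    NonvanishingAtVertices (F * G) Γ := fun x y hx hy => by
  simpa only [rePart_mul, imPart_mul, map_sub, map_add, map_mul] using
    mul_ne_zero_of_parts (hF x y hx hy) (hG x y hx hy)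

omit [IsStrictOrderedRing R] in
theorem NonvanishingAtVertices.conj {F : MvPolynomial (Fin 2) (Cplx R)} {Γ : Rectangle R}
    (hF : NonvanishingAtVertices F Γ) : NonvanishingAtVertices (conj F) Γ := fun x y hx hy => by
  simpa only [rePart_conj, imPart_conj, map_neg, neg_eq_zero] using hF x y hx hy

theorem windingNumber_conj (F : MvPolynomial (Fin 2) (Cplx R)) (Γ : Rectangle R) :
    windingNumber (conj F) Γ = -windingNumber F Γ := by
  simp only [windingNumber_eq, rePart_conj, imPart_conj, restrictHoriz, restrictVert, map_neg,
    indIncr_neg_right]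
  ring

/-- Multiplicativity of the winding number. -/
theorem windingNumber_mul [IsRealClosed R] {F G : MvPolynomial (Fin 2) (Cplx R)} {Γ : Rectangle R}
    (hF : NonvanishingAtVertices F Γ) (hG : NonvanishingAtVertices G Γ) :
    windingNumber (F * G) Γ = windingNumber F Γ + windingNumber G Γ := by
  have horiz : ∀ y, (y = Γ.y₀ ∨ y = Γ.y₁) → _ := fun y hy =>
    indIncr_mul (p₁ := restrictHoriz (rePart F) y) (q₁ := restrictHoriz (imPart F) y)
      (p₂ := restrictHoriz (rePart G) y) (q₂ := restrictHoriz (imPart G) y) Γ.hx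
      (by simpa only [eval_restrictHoriz] using hF _ _ (Or.inl rfl) hy)
      (by simpa only [eval_restrictHoriz] using hF _ _ (Or.inr rfl) hy)
      (by simpa only [eval_restrictHoriz] using hG _ _ (Or.inl rfl) hy)
      (by simpa only [eval_restrictHoriz] using hG _ _ (Or.inr rfl) hy)
  have vert : ∀ x, (x = Γ.x₀ ∨ x = Γ.x₁) → _ := fun x hx =>
    indIncr_mul (p₁ := restrictVert (rePart F) x) (q₁ := restrictVert (imPart F) x)
      (p₂ := restrictVert (rePart G) x) (q₂ := restrictVert (imPart G) x) Γ.hy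
      (by simpa only [eval_restrictVert] using hF _ _ hx (Or.inl rfl))
      (by simpa only [eval_restrictVert] using hF _ _ hx (Or.inr rfl))
      (by simpa only [eval_restrictVert] using hG _ _ hx (Or.inl rfl))
      (by simpa only [eval_restrictVert] using hG _ _ hx (Or.inr rfl))
  simp only [imProd, eval_mul, eval_add, eval_restrictHoriz] at horiz
  simp only [imProd, eval_mul, eval_add, eval_restrictVert] at vert
  simp only [windingNumber_eq, restrictHoriz_rePart_mul, restrictHoriz_imPart_mul,
    restrictVert_rePart_mul, restrictVert_imPart_mul]
  -- The correction at each vertex occurs on its two adjacent edges with opposite orientation, so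
  -- all corrections cancel.
  rw [horiz _ (Or.inl rfl), horiz _ (Or.inr rfl), vert _ (Or.inl rfl), vert _ (Or.inr rfl)]
  ring

theorem windingNumber_mul_left {H : MvPolynomial (Fin 2) (Cplx R)} (Γ : Rectangle R)
    (hH : imPart H = 0) (hh : ∀ y, restrictHoriz (rePart H) y ≠ 0)
    (hv : ∀ x, restrictVert (rePart H) x ≠ 0) (F : MvPolynomial (Fin 2) (Cplx R)) :
    windingNumber (H * F) Γ = windingNumber F Γ := by
  have e1 : ∀ y, restrictHoriz (imPart H) y = 0 := fun y => by simp [hH, restrictHoriz]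
  have e2 : ∀ x, restrictVert (imPart H) x = 0 := fun x => by simp [hH, restrictVert]
  simp only [windingNumber_eq, restrictHoriz_rePart_mul, restrictHoriz_imPart_mul,
    restrictVert_rePart_mul, restrictVert_imPart_mul, e1, e2, zero_mul, sub_zero, add_zero,
    indIncr_mul_left (hh _), indIncr_mul_left (hv _)]

/-- The extra factor in `F * conj G` is `(X - z.re)² + (Y - z.im)²`, which is real. No condition on
`z` is needed, so this also cancels common zeros at vertices. -/
theorem windingNumberQuot_mul_left (z : Cplx R) (F G : (Cplx R)[X]) (Γ : Rectangle R) :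
    windingNumberQuot ((X - C z) * F) ((X - C z) * G) Γ = windingNumberQuot F G Γ := by
  have : toXY ((X - C z) * F) * conj (toXY ((X - C z) * G)) =
      (toXY (X - C z) * conj (toXY (X - C z))) * (toXY F * conj (toXY G)) := by
    rw [toXY_mul, toXY_mul, conj_mul]; ring
  rw [windingNumberQuot, this, windingNumber_mul_left, windingNumberQuot]
  · rw [imPart_mul, rePart_conj, imPart_conj]; ring
  · intro y h
    -- One unit away from `z.re` the sum of squares is at least 1, so its restriction to the line is
    -- not the zero polynomial.
    have := congrArg (eval (z.re + 1)) h
    rw [eval_restrictHoriz, rePart_mul, rePart_conj, imPart_conj, toXY_X_sub_C] at this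
    simp at this
    nlinarith [mul_self_nonneg (y - z.im)]
  · intro x h
    have := congrArg (eval (z.im + 1)) h
    rw [eval_restrictVert, rePart_mul, rePart_conj, imPart_conj, toXY_X_sub_C] at this
    simp at this
    nlinarith [mul_self_nonneg (x - z.re)]

omit [LinearOrder R] [IsStrictOrderedRing R] in
theorem _root_.QuadraticAlgebra.ne_zero_parts {c : Cplx R} (hc : c ≠ 0) : ¬(c.re = 0 ∧ c.im = 0) :=
  fun h => hc (QuadraticAlgebra.ext h.1 h.2)

omit [IsStrictOrderedRing R] in
theorem nonvanishingAtVertices_C {c : Cplx R} (hc : c ≠ 0) (Γ : Rectangle R) :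
    NonvanishingAtVertices (toXY (C c)) Γ := fun x y _ _ => by
  simpa [toXY_C] using QuadraticAlgebra.ne_zero_parts hc

omit [IsStrictOrderedRing R] in
theorem windingNumber_C (c : Cplx R) (Γ : Rectangle R) : windingNumber (toXY (C c)) Γ = 0 := by
  simp [windingNumber_eq, toXY_C, restrictHoriz, restrictVert, indIncr_const_right]

theorem nonvanishingAtVertices_X_sub_C {z : Cplx R} {Γ : Rectangle R} (hz : z ∉ Γ.vertices) :
    NonvanishingAtVertices (toXY (X - C z)) Γ := fun x y hx hy => by
  simp only [toXY_X_sub_C, rePart_ofParts, imPart_ofParts, map_sub, MvPolynomial.eval_X,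
    MvPolynomial.eval_C, sub_eq_zero, Matrix.cons_val_zero, Matrix.cons_val_one]
  rintro ⟨rfl, rfl⟩
  exact hz ⟨hx, hy⟩

open Classical in
/-- The contribution of a zero at `z` to the winding number. -/
def weight (Γ : Rectangle R) (z : Cplx R) : ℚ :=
  (if z ∈ Γ.inside then 1 else 0) + 1 / 2 * (if z ∈ Γ.edges then 1 else 0)

/-- On horizontal edges the imaginary part is constant and the index is 0. The vertical edges give
the product of a horizontal and a vertical factor, each 1 inside its interval, 1/2 at an end and 0
outside. At a vertex this product would be 1/4, whereas `weight` is 0; hence the exclusion. -/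
theorem windingNumber_X_sub_C {z : Cplx R} {Γ : Rectangle R} (hz : z ∉ Γ.vertices) :
    windingNumber (toXY (X - C z)) Γ = weight Γ z := by
  have h1 : ∀ y, restrictHoriz (MvPolynomial.X 1 - MvPolynomial.C z.im) y = C (y - z.im) := by
    simp [restrictHoriz]
  have h2 : ∀ x, restrictVert (MvPolynomial.X 1 - MvPolynomial.C z.im) x = X - C z.im := by
    simp [restrictVert]
  have h3 : ∀ x, restrictVert (MvPolynomial.X 0 - MvPolynomial.C z.re) x = C (x - z.re) := by
    simp [restrictVert]
  simp only [windingNumber_eq, toXY_X_sub_C, rePart_ofParts, imPart_ofParts, h1, h2, h3,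
    indIncr_const_right, indIncr_C_X_sub_C]
  have e := sgn_sub_sgn (t := z.re) Γ.hx
  rw [sub_eq_iff_eq_add] at e
  rw [e]
  have hx := Γ.hx
  have hy := Γ.hy
  simp only [Rectangle.vertices, Set.mem_ofPred_eq, eq_comm (a := z.re), eq_comm (a := z.im)] at hz
  simp only [weight, Rectangle.inside, Rectangle.edges, Set.mem_ofPred_eq, eq_comm (a := z.re),
    eq_comm (a := z.im)]
  have a1 : Γ.x₀ = z.re → z.re ∉ Set.Ioo Γ.x₀ Γ.x₁ := fun h => by simp [h]
  have a2 : Γ.x₁ = z.re → z.re ∉ Set.Ioo Γ.x₀ Γ.x₁ := fun h => by simp [h]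
  have a3 : Γ.y₀ = z.im → z.im ∉ Set.Ioo Γ.y₀ Γ.y₁ := fun h => by simp [h]
  have a4 : Γ.y₁ = z.im → z.im ∉ Set.Ioo Γ.y₀ Γ.y₁ := fun h => by simp [h]
  have a5 : ¬(Γ.x₀ = z.re ∧ Γ.x₁ = z.re) := fun h => hx.ne (h.1.trans h.2.symm)
  have a6 : ¬(Γ.y₀ = z.im ∧ Γ.y₁ = z.im) := fun h => hy.ne (h.1.trans h.2.symm)
  by_cases c1 : z.re ∈ Set.Ioo Γ.x₀ Γ.x₁ <;> by_cases c2 : Γ.x₀ = z.re <;>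
  by_cases c3 : Γ.x₁ = z.re <;> by_cases c4 : z.im ∈ Set.Ioo Γ.y₀ Γ.y₁ <;>
  by_cases c5 : Γ.y₀ = z.im <;> by_cases c6 : Γ.y₁ = z.im <;>
  simp only [c1, c2, c3, c4, c5, c6, true_and, and_true, or_true, false_and, and_false,
    or_false, not_true, not_false_eq_true, if_true, if_false, imp_false, implies_true,
    and_self, or_self, true_implies] at hz a1 a2 a3 a4 a5 a6 ⊢ <;> ring

end Winding

/-! ### Factorization into linear factors and counting of zeros and poles -/

section ArgumentPrinciple

variable {R : Type*} [Field R] [LinearOrder R] [IsStrictOrderedRing R]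

theorem windingNumberQuot_multiset_prod_mul (s : Multiset (Cplx R)) (F G : (Cplx R)[X])
    (Γ : Rectangle R) :
    windingNumberQuot ((s.map fun z => X - C z).prod * F) ((s.map fun z => X - C z).prod * G) Γ =
      windingNumberQuot F G Γ := by
  induction s using Multiset.induction_on with
  | empty => simp
  | cons z s ih =>
    rw [Multiset.map_cons, Multiset.prod_cons, mul_assoc, mul_assoc, windingNumberQuot_mul_left, ih]

variable [IsRealClosed R]

theorem windingNumber_C_mul_prod {c : Cplx R} (hc : c ≠ 0) {Γ : Rectangle R}
    {s : Multiset (Cplx R)} (hs : ∀ z ∈ s, z ∉ Γ.vertices) :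
    NonvanishingAtVertices (toXY (C c * (s.map fun z => X - C z).prod)) Γ ∧
      windingNumber (toXY (C c * (s.map fun z => X - C z).prod)) Γ = (s.map (weight Γ)).sum := by
  induction s using Multiset.induction_on with
  | empty => simpa using ⟨nonvanishingAtVertices_C hc Γ, windingNumber_C c Γ⟩
  | cons z s ih =>
    obtain ⟨h1, h2⟩ := ih fun w hw => hs w (Multiset.mem_cons_of_mem hw)
    have hz := nonvanishingAtVertices_X_sub_C (hs z (Multiset.mem_cons_self z s))
    rw [Multiset.map_cons, Multiset.prod_cons, mul_left_comm, toXY_mul, Multiset.map_cons,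
      Multiset.sum_cons]
    exact ⟨hz.mul h1, by
      rw [windingNumber_mul hz h1, h2, windingNumber_X_sub_C (hs z (Multiset.mem_cons_self z s))]⟩

open Classical in
theorem eq_prod_filter_mul (F : (Cplx R)[X]) (S : Set (Cplx R)) :
    F = ((F.roots.filter (· ∈ S)).map fun z => X - C z).prod *
      (C F.leadingCoeff * ((F.roots.filter (· ∉ S)).map fun z => X - C z).prod) := by
  conv_lhs => rw [(IsAlgClosed.splits F).eq_prod_roots,
    ← Multiset.filter_add_not (· ∈ S) F.roots, Multiset.map_add, Multiset.prod_add]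
  ring

open Classical in
omit [IsStrictOrderedRing R] [IsRealClosed R] in
theorem sum_weight_filter (s : Multiset (Cplx R)) (Γ : Rectangle R) :
    ((s.filter (· ∉ Γ.vertices)).map (weight Γ)).sum = (s.map (weight Γ)).sum := by
  conv_rhs => rw [← Multiset.filter_add_not (· ∈ Γ.vertices) s, Multiset.map_add, Multiset.sum_add]
  rw [Multiset.sum_eq_zero (s := (s.filter (· ∈ Γ.vertices)).map (weight Γ)), zero_add]
  intro q hq
  obtain ⟨z, hz, rfl⟩ := Multiset.mem_map.1 hq
  obtain ⟨h1, h2⟩ := (Multiset.mem_filter.1 hz).2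
  have e1 : z ∉ Γ.inside := by
    rintro ⟨h, -⟩
    rcases h1 with h1 | h1 <;> simp [h1] at h
  have e2 : z ∉ Γ.edges := by
    rintro (⟨h, -⟩ | ⟨-, h⟩)
    · rcases h1 with h1 | h1 <;> simp [h1] at h
    · rcases h2 with h2 | h2 <;> simp [h2] at h
  simp [weight, e1, e2]

/-- Valuation 0 at the vertices means that `F` and `G` have the same vertex roots, which cancel.
Additivity applies to the remaining factors, and restoring the vertex roots costs nothing because
their weight is 0. -/
theorem windingNumberQuot_eq_sum_weight {F G : (Cplx R)[X]} (hF : F ≠ 0) (hG : G ≠ 0)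
    {Γ : Rectangle R} (hvert : ∀ z ∈ Γ.vertices, val F G z = 0) :
    windingNumberQuot F G Γ = (F.roots.map (weight Γ)).sum - (G.roots.map (weight Γ)).sum := by
  classical
  have hroots : G.roots.filter (· ∈ Γ.vertices) = F.roots.filter (· ∈ Γ.vertices) := by
    ext z
    rw [Multiset.count_filter, Multiset.count_filter, count_roots, count_roots]
    split_ifs with hz
    · have := hvert z hz
      rw [val] at this
      omega
    · rfl
  obtain ⟨hF₁, hF₂⟩ := windingNumber_C_mul_prod (Γ := Γ) (leadingCoeff_ne_zero.2 hF)
    (s := F.roots.filter (· ∉ Γ.vertices)) fun z hz => (Multiset.mem_filter.1 hz).2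
  obtain ⟨hG₁, hG₂⟩ := windingNumber_C_mul_prod (Γ := Γ) (leadingCoeff_ne_zero.2 hG)
    (s := G.roots.filter (· ∉ Γ.vertices)) fun z hz => (Multiset.mem_filter.1 hz).2
  conv_lhs => rw [eq_prod_filter_mul F Γ.vertices, eq_prod_filter_mul G Γ.vertices, hroots,
    windingNumberQuot_multiset_prod_mul, windingNumberQuot, windingNumber_mul hF₁ hG₁.conj,
    windingNumber_conj, hF₂, hG₂, sum_weight_filter, sum_weight_filter]
  ring

omit [LinearOrder R] [IsStrictOrderedRing R] [IsRealClosed R] in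
open Classical in
theorem finsum_mem_eq_sum_ite {f : Cplx R → ℕ} {T : Finset (Cplx R)} (h : ∀ z ∉ T, f z = 0)
    (S : Set (Cplx R)) : ((∑ᶠ z ∈ S, f z : ℕ) : ℚ) = ∑ z ∈ T, if z ∈ S then (f z : ℚ) else 0 := by
  rw [finsum_mem_def, finsum_eq_sum_of_support_subset (s := T), Nat.cast_sum]
  · refine Finset.sum_congr rfl fun z _ => ?_
    by_cases hz : z ∈ S <;> simp [hz]
  · intro z hz
    by_contra hzT
    have := h z hzT
    exact hz (by by_cases hz : z ∈ S <;> simp [hz, this])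

open Classical in
omit [IsRealClosed R] in
theorem sum_map_roots_indicator (F : (Cplx R)[X]) {T : Finset (Cplx R)}
    (hT : F.roots.toFinset ⊆ T) (S : Set (Cplx R)) :
    (F.roots.map fun z => if z ∈ S then (1 : ℚ) else 0).sum =
      ∑ z ∈ T, if z ∈ S then (F.rootMultiplicity z : ℚ) else 0 := by
  rw [Finset.sum_multiset_map_count, Finset.sum_subset hT]
  · refine Finset.sum_congr rfl fun z _ => ?_
    rw [count_roots]
    split_ifs <;> simp
  · intro z _ hz
    rw [Multiset.count_eq_zero_of_notMem (by simpa using hz), zero_smul]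

-- Pointwise, the truncations satisfy `max(v, 0) - max(-v, 0) = v`, so common roots of `F` and `G`
-- drop out of the count.
open Classical in
omit [IsRealClosed R] in
theorem zeroCount_sub_poleCount (F G : (Cplx R)[X]) (S : Set (Cplx R)) :
    (zeroCount F G S : ℚ) - poleCount F G S =
      (F.roots.map fun z => if z ∈ S then (1 : ℚ) else 0).sum -
        (G.roots.map fun z => if z ∈ S then (1 : ℚ) else 0).sum := by
  let T := F.roots.toFinset ∪ G.roots.toFinset
  have hval : ∀ z ∉ T, val F G z = 0 := fun z hz => by
    simp only [T, Finset.mem_union, Multiset.mem_toFinset, not_or] at hz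
    rw [val, ← count_roots, ← count_roots, Multiset.count_eq_zero_of_notMem hz.1,
      Multiset.count_eq_zero_of_notMem hz.2, sub_self]
  rw [zeroCount, poleCount, finsum_mem_eq_sum_ite (T := T) (fun z hz => by simp [hval z hz]),
    finsum_mem_eq_sum_ite (T := T) (fun z hz => by simp [hval z hz]),
    sum_map_roots_indicator F (T := T) Finset.subset_union_left,
    sum_map_roots_indicator G (T := T) Finset.subset_union_right, ← Finset.sum_sub_distrib,
    ← Finset.sum_sub_distrib]
  refine Finset.sum_congr rfl fun z _ => ?_
  split_ifs
  · have h : ((val F G z).toNat : ℤ) - ((-val F G z).toNat : ℤ) =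
        (F.rootMultiplicity z : ℤ) - G.rootMultiplicity z := by
      rw [val]; omega
    exact_mod_cast h
  · simp

omit [IsStrictOrderedRing R] [IsRealClosed R] in
theorem sum_map_weight (s : Multiset (Cplx R)) (Γ : Rectangle R) [DecidablePred (· ∈ Γ.inside)]
    [DecidablePred (· ∈ Γ.edges)] :
    (s.map (weight Γ)).sum = (s.map fun z => if z ∈ Γ.inside then (1 : ℚ) else 0).sum +
      1 / 2 * (s.map fun z => if z ∈ Γ.edges then (1 : ℚ) else 0).sum := by
  rw [← Multiset.sum_map_mul_left, ← Multiset.sum_map_add]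
  congr! 2 with z
  simp only [weight]
  congr!

end ArgumentPrinciple

end AlgWinding

end

theorem theorem1p5 {R : Type*} [Field R] [LinearOrder R] [IsStrictOrderedRing R] [IsRealClosed R]
    (F G : Polynomial (AlgWinding.Cplx R)) (hF : F ≠ 0) (hG : G ≠ 0)
    (Γ : AlgWinding.Rectangle R)
    (hvert : ∀ z ∈ Γ.vertices, AlgWinding.val F G z = 0) :
    AlgWinding.windingNumberQuot F G Γ =
      ((AlgWinding.zeroCount F G Γ.inside : ℚ) - (AlgWinding.poleCount F G Γ.inside : ℚ)) +
      1 / 2 * ((AlgWinding.zeroCount F G Γ.edges : ℚ) -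
        (AlgWinding.poleCount F G Γ.edges : ℚ)) := by
  classical
  rw [AlgWinding.windingNumberQuot_eq_sum_weight hF hG hvert, AlgWinding.zeroCount_sub_poleCount,
    AlgWinding.zeroCount_sub_poleCount, AlgWinding.sum_map_weight, AlgWinding.sum_map_weight]
  ring
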